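/- Let $\mathscr Q_n$ be a non-singular quadric in $\mathrm{PG}(n,2)$ of projective index $g$ (the largest dimension of a subspace contained in $\mathscr Q_n$), given by a quadratic form $Q$ on an $(n+1)$-dimensional vector space $V$ over $\mathrm{GF}(2)$, with polar form $B(x,y)=Q(x+y)-Q(x)-Q(y)$; dimensions below are projective. Let $s$ be an integer with $0<s<g$. *The graph $\Gamma_s$.* Let $\Gamma$ be the point-graph of $\mathscr Q_n$: its vertices are the points of $\mathscr Q_n$, and two distinct points are adjacent when the line joining them is contained in $\mathscr Q_n$. Let $\alpha_s$ be an $s$-dimensional subspace contained in $\mathscr Q_n$, and let $\mathcal X_s$ be the set of points of $\mathscr Q_n\setminus\alpha_s$ that lie in some $(s+1)$-dimensional subspace $\Pi$ with $\alpha_s\subset\Pi\subset\mathscr Q_n$. Then $\Gamma_s$ is obtained from $\Gamma$ as follows: for each vertex $R\notin\mathcal X_s$ with exactly $\frac12|\mathcal X_s|$ neighbours in $\mathcal X_s$, delete the edges from $R$ to $\mathcal X_s$ and join $R$ to the other $\frac12|\mathcal X_s|$ vertices of $\mathcal X_s$. *The graph $\Gamma_K$.* A spread of $\mathscr Q_n$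 is a set $\mathcal S$ of $g$-dimensional subspaces contained in $\mathscr Q_n$ such that every point of $\mathscr Q_n$ lies in exactly one of them. Kantor's graph $\Gamma_K$ of $\mathcal S$ has as vertices the hyperplanes ($(g-1)$-dimensional subspaces) of the members of $\mathcal S$; two distinct vertices $X,Y$, viewed as linear subspaces of $V$, are adjacent when $X\cap Y^{\perp}\neq 0$, where $Y^\perp=\{v\in V : B(y,v)=0 \text{ for all } y\in Y\}$. **Theorem.** For every choice of $\alpha_s$, the vertices of $\Gamma_s$ cannot be partitioned into cliques of maximum size. If $\mathcal S$ is any spread of $\mathscr Q_n$, then the vertices of its graph $\Gamma_K$ can be partitioned into cliques of maximum size. In particular, $\Gamma_K$ is not isomorphic to $\Gamma_s$. -/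

import Mathlib

open scoped LinearAlgebra.Projectivization

/-! Projective geometry `PG(n, q)` is the lattice of subspaces of a vector space `V` of dimension
`n + 1`; its points are the elements of `ℙ K V`, and a subspace of projective dimension `k` is a
`Submodule K V` of linear dimension `k + 1`. The quadric is the zero locus of a quadratic form. -/

section Quadric

variable {K V : Type*} [Field K] [AddCommGroup V] [Module K V]

/-- The projective subspace given by `W` is contained in the quadric `Q = 0`. -/
def LiesOn (Q : QuadraticForm K V) (W : Submodule K V) : Prop :=
  ∀ v ∈ W, Q v = 0

/-- The quadric `Q = 0` is non-singular: no nonzero vector `v` with `Q v = 0` is orthogonal to the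
whole space for the polar form of `Q`. -/
def IsNonsingularQuadric (Q : QuadraticForm K V) : Prop :=
  Q.radical = ⊥

/-- `g` is the projective index of the quadric: the largest projective dimension of a subspace
contained in it. -/
def IsProjectiveIndex (Q : QuadraticForm K V) (g : ℕ) : Prop :=
  IsGreatest {k : ℕ | ∃ W : Submodule K V, LiesOn Q W ∧ Module.finrank K W = k + 1} g

/-- The points of the quadric `Q = 0`. -/
abbrev QuadricPoint (Q : QuadraticForm K V) : Type _ :=
  {P : ℙ K V // LiesOn Q P.submodule}

/-- The point-graph of the quadric: two distinct points are adjacent when the line joining them is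
contained in the quadric. -/
def pointGraph (Q : QuadraticForm K V) : SimpleGraph (QuadricPoint Q) where
  Adj P P' := P ≠ P' ∧ LiesOn Q (P.1.submodule ⊔ P'.1.submodule)
  symm := ⟨fun _ _ h => ⟨h.1.symm, by rw [sup_comm]; exact h.2⟩⟩
  loopless := ⟨fun _ h => h.1 rfl⟩

/-- The points of the quadric not in `α` that lie in some subspace contained in the quadric which
contains `α` and has dimension one more than `α` (the points of type (ii)). -/
def typeTwoPoints (Q : QuadraticForm K V) (α : Submodule K V) : Set (QuadricPoint Q) :=
  {P | ¬ P.1.submodule ≤ α ∧ ∃ W : Submodule K V, α ≤ W ∧ LiesOn Q W ∧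
    Module.finrank K W = Module.finrank K α + 1 ∧ P.1.submodule ≤ W}

end Quadric

section GodsilMcKay

variable {U : Type*}

/-- `R` is outside `X` and is adjacent to exactly half of the vertices in `X`. -/
def HalfAdjacent (G : SimpleGraph U) (X : Set U) (R : U) : Prop :=
  R ∉ X ∧ 2 * (G.neighborSet R ∩ X).ncard = X.ncard

/-- The pairs of vertices whose adjacency is changed by the Godsil-McKay construction. -/
def IsSwitchedPair (G : SimpleGraph U) (X : Set U) (u v : U) : Prop :=
  (u ∈ X ∧ HalfAdjacent G X v) ∨ (v ∈ X ∧ HalfAdjacent G X u)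

/-- The graph obtained from `G` by the Godsil-McKay construction with the partition `{X, Xᶜ}`: for
each vertex `R` outside `X` with exactly half of `X` as neighbours, the edges from `R` to `X` are
deleted and `R` is joined to the other half of `X`. -/
def godsilMcKay (G : SimpleGraph U) (X : Set U) : SimpleGraph U where
  Adj u v := (G.Adj u v ∧ ¬ IsSwitchedPair G X u v) ∨ (¬ G.Adj u v ∧ IsSwitchedPair G X u v)
  symm := ⟨fun u v h => by
    have hs : IsSwitchedPair G X v u ↔ IsSwitchedPair G X u v := Or.comm
    rwa [G.adj_comm v u, hs]⟩
  loopless := ⟨fun u h => by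
    rcases h with h | ⟨_, h⟩
    · exact G.irrefl h.1
    · rcases h with h | h <;> exact h.2.1 h.1⟩

/-- The vertices of `G` can be partitioned into cliques of the largest size occurring in `G`. -/
def HasMaximumCliquePartition (G : SimpleGraph U) : Prop :=
  ∃ 𝒞 : Set (Set U), Setoid.IsPartition 𝒞 ∧
    ∀ C ∈ 𝒞, G.IsClique C ∧ ∀ D : Set U, G.IsClique D → D.encard ≤ C.encard

end GodsilMcKay

section Switched

variable {K V : Type*} [Field K] [AddCommGroup V] [Module K V]

/-- The graph `Γ_s` built from an `s`-dimensional subspace `α` contained in the quadric. -/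
def switchedGraph (Q : QuadraticForm K V) (α : Submodule K V) : SimpleGraph (QuadricPoint Q) :=
  godsilMcKay (pointGraph Q) (typeTwoPoints Q α)

end Switched

section Kantor

variable {K V : Type*} [Field K] [AddCommGroup V] [Module K V]

/-- A spread of a quadric of projective index `g`: a set of generators (`g`-dimensional subspaces
contained in the quadric) such that every point of the quadric is in exactly one of them. -/
structure IsSpread (Q : QuadraticForm K V) (g : ℕ) (𝒮 : Set (Submodule K V)) : Prop where
  liesOn : ∀ A ∈ 𝒮, LiesOn Q A
  finrank_eq : ∀ A ∈ 𝒮, Module.finrank K A = g + 1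
  existsUnique : ∀ P : ℙ K V, LiesOn Q P.submodule → ∃! A, A ∈ 𝒮 ∧ P.submodule ≤ A

/-- The hyperplanes of the members of `𝒮`. -/
abbrev SpreadHyperplane (𝒮 : Set (Submodule K V)) : Type _ :=
  {H : Submodule K V // ∃ A ∈ 𝒮, H ≤ A ∧ Module.finrank K H + 1 = Module.finrank K A}

/-- For subspaces `X`, `Y` of equal dimension, `X ∩ Y^⊥ ≠ 0` is a symmetric condition. -/
theorem inf_orthogonal_ne_bot_symm [FiniteDimensional K V] (Q : QuadraticForm K V)
    {X Y : Submodule K V} (hd : Module.finrank K X = Module.finrank K Y)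
    (h : X ⊓ Y.orthogonalBilin Q.polarBilin ≠ ⊥) :
    Y ⊓ X.orthogonalBilin Q.polarBilin ≠ ⊥ := by
  have key : ∀ S T : Submodule K V, S ⊓ T.orthogonalBilin Q.polarBilin = ⊥ ↔
      Function.Injective (Q.polarBilin.domRestrict₁₂ S T) := by
    intro S T
    rw [injective_iff_map_eq_zero, Submodule.eq_bot_iff]
    constructor
    · intro hb x hx
      refine Subtype.ext (hb x.1 ⟨x.2, fun t ht => ?_⟩)
      have h0 : QuadraticMap.polar Q x.1 t = 0 := LinearMap.congr_fun hx ⟨t, ht⟩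
      exact (QuadraticMap.polar_comm Q t x.1).trans h0
    · rintro hi x ⟨hx, hx'⟩
      have := hi ⟨x, hx⟩ (LinearMap.ext fun t => by
        have h0 : QuadraticMap.polar Q t.1 x = 0 := hx' t.1 t.2
        exact (QuadraticMap.polar_comm Q x t.1).trans h0)
      simpa using this
  rw [Ne, key] at h ⊢
  intro hYX
  apply h
  have hflip : (Q.polarBilin.domRestrict₁₂ Y X) = (Q.polarBilin.domRestrict₁₂ X Y).flip := by
    ext a b
    exact QuadraticMap.polar_comm Q a.1 b.1
  rw [hflip] at hYX
  rw [LinearMap.injective_iff_surjective_of_finrank_eq_finrank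
    (by rw [hd]; exact Subspace.dual_finrank_eq.symm)]
  exact LinearMap.flip_injective_iff₂.mp hYX

/-- Kantor's graph of a spread: the vertices are the hyperplanes of the members of the spread, and
two distinct vertices `X`, `Y` are adjacent when `X ∩ Y^⊥ ≠ 0`, where `⊥` is taken with respect to
the polar form of `Q`. -/
def kantorGraph [FiniteDimensional K V] {Q : QuadraticForm K V} {g : ℕ}
    {𝒮 : Set (Submodule K V)} (h𝒮 : IsSpread Q g 𝒮) : SimpleGraph (SpreadHyperplane 𝒮) where
  Adj X Y := X ≠ Y ∧ X.1 ⊓ Y.1.orthogonalBilin Q.polarBilin ≠ ⊥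
  symm := ⟨fun X Y h => by
    obtain ⟨A, hA, -, hXA⟩ := X.2
    obtain ⟨B, hB, -, hYB⟩ := Y.2
    refine ⟨h.1.symm, inf_orthogonal_ne_bot_symm Q ?_ h.2⟩
    have h1 := h𝒮.finrank_eq A hA
    have h2 := h𝒮.finrank_eq B hB
    omega⟩
  loopless := ⟨fun _ h => h.1 rfl⟩

end Kantor

/-! Points of the quadric are identified with nonzero singular vectors (`singularVector`), and
adjacency in the point-graph with orthogonality for the polar form `B`.

**The graph `Γ_s`.** The set that is switched consists of the singular vectors of `α^⊥ \ α`, and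
the vertices whose edges change are those outside `α^⊥`; between these two sets, `Γ_s` joins
vectors that are not orthogonal (`isSwitchedPair_iff`). A generator through `α` remains a clique,
so a clique `C` of maximum size has at least `2 ^ (g + 1) - 1` elements. If `C` misses `α^⊥ \ α` or
lies in `α^⊥`, its elements are pairwise orthogonal, so `C` is a generator; a generator always
meets `α^⊥ \ α`, so `C` lies in `α^⊥` and contains `α`. Otherwise the points of `C` in `α` and the
differences of points of `C` of the same kind span a totally singular subspace `U` orthogonal to
`C`, and counting inside the cosets of `U` shows that `C` has exactly `2 ^ s - 1` points in `α` and
`2 ^ g - 2 ^ s` points in `α^⊥ \ α` (`IsSwitchedClique.le_or_ncard_inter`). In a partition into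
maximum cliques, a block containing `α` would be the only one to meet `α`, hence the only block,
although some singular vector is outside `α^⊥`. So all blocks are of the second kind; counting the
points of `α` gives `2 ^ s - 1 ∣ 2 ^ (s + 1) - 1`, so that `s = 1` and there are three blocks. Then
`α^⊥ \ α` has `3 (2 ^ g - 2)` singular vectors, a number not divisible by `4`, whereas this set is
a union of cosets of `α`.

**Kantor's graph.** The `2 ^ (g + 1) - 1` hyperplanes of a member of the spread form a clique, and
these cliques partition the vertices. That no clique is larger is an instance of Delsarte's bound.
Let `K` be the matrix `(-1) ^ B(x, y)` on the singular vectors, zero included. Non-singularity gives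
`K² = b K + c` with `c > 0` (`characterMatrix_mul_self`), and the indicator function of a generator
is an eigenvector for `2 ^ (g + 1)`; so `2 ^ (g + 1) - K` is positive semidefinite
(`characterForm_self_nonneg`). For this form the indicator functions of adjacent vertices have
non-positive inner product, and comparing their sum with the indicator function of the zero vector
bounds the number of vertices in a clique (`card_add_one_le_of_finrank_inf_lt`). -/

/-! ### Totally singular subspaces over `GF(2)` -/

section TotallySingular

open Module QuadraticMap

variable {V : Type*} [AddCommGroup V] [Module (ZMod 2) V] {Q : QuadraticForm (ZMod 2) V}

/-- The subspace `W^⊥` for the polar form of `Q`. -/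
abbrev polarPerp (Q : QuadraticForm (ZMod 2) V) (W : Submodule (ZMod 2) V) :
    Submodule (ZMod 2) V :=
  W.orthogonalBilin Q.polarBilin

theorem mem_polarPerp {W : Submodule (ZMod 2) V} {v : V} :
    v ∈ polarPerp Q W ↔ ∀ w ∈ W, polar Q w v = 0 := Iff.rfl

theorem zmod_two_eq_zero_or_one (a : ZMod 2) : a = 0 ∨ a = 1 := by
  revert a; decide

theorem add_self_zmod_two (v : V) : v + v = 0 := by
  rw [← two_smul (ZMod 2) v, show (2 : ZMod 2) = 0 from rfl, zero_smul]

theorem add_add_self_zmod_two (v w : V) : v + (v + w) = w := by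
  rw [← add_assoc, add_self_zmod_two, zero_add]

theorem polar_self_eq_zero (Q : QuadraticForm (ZMod 2) V) (x : V) : polar Q x x = 0 := by
  rw [QuadraticMap.polar_self, two_smul, CharTwo.add_self_eq_zero]

theorem LiesOn.polar_eq_zero {W : Submodule (ZMod 2) V} (hW : LiesOn Q W) {x y : V}
    (hx : x ∈ W) (hy : y ∈ W) : polar Q x y = 0 := by
  simp [polar, hW _ hx, hW _ hy, hW _ (W.add_mem hx hy)]

theorem LiesOn.sup {W W' : Submodule (ZMod 2) V} (hW : LiesOn Q W) (hW' : LiesOn Q W')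
    (h : W' ≤ polarPerp Q W) : LiesOn Q (W ⊔ W') := by
  intro v hv
  obtain ⟨x, hx, y, hy, rfl⟩ := Submodule.mem_sup.1 hv
  rw [QuadraticMap.map_add Q, hW x hx, hW' y hy, mem_polarPerp.1 (h hy) x hx]
  simp

theorem liesOn_span_singleton {v : V} (hv : Q v = 0) : LiesOn Q (Submodule.span (ZMod 2) {v}) := by
  intro x hx
  obtain ⟨a, rfl⟩ := Submodule.mem_span_singleton.1 hx
  simp [QuadraticMap.map_smul, hv]

/-- Pairwise orthogonal singular vectors span a totally singular subspace. -/
theorem liesOn_span {C : Set V} (h0 : ∀ x ∈ C, Q x = 0)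
    (h : ∀ x ∈ C, ∀ y ∈ C, polar Q x y = 0) : LiesOn Q (Submodule.span (ZMod 2) C) := by
  have h1 : ∀ x ∈ C, Submodule.span (ZMod 2) C ≤ LinearMap.ker (Q.polarBilin x) := fun x hx =>
    Submodule.span_le.2 fun y hy => h x hx y hy
  intro v hv
  induction hv using Submodule.span_induction with
  | mem x hx => exact h0 x hx
  | zero => simp
  | smul a x _ hx => simp [QuadraticMap.map_smul, hx]
  | add x y hx' hy' hx hy =>
    have h2 : Submodule.span (ZMod 2) C ≤ LinearMap.ker (Q.polarBilin y) :=
      Submodule.span_le.2 fun z hz => (polar_comm Q y z).trans (h1 z hz hy')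
    rw [QuadraticMap.map_add Q, hx, hy, (polar_comm Q x y).trans (h2 hx')]
    simp

theorem IsProjectiveIndex.finrank_le {g : ℕ} (hg : IsProjectiveIndex Q g)
    {W : Submodule (ZMod 2) V} (hW : LiesOn Q W) : finrank (ZMod 2) W ≤ g + 1 := by
  rcases Nat.eq_zero_or_pos (finrank (ZMod 2) W) with h | h
  · omega
  · have := hg.2 ⟨W, hW, (Nat.succ_pred_eq_of_pos h).symm⟩
    simp only [Nat.pred_eq_sub_one] at this
    omega

/-- A nonzero totally singular subspace of a non-singular quadric is not orthogonal to all
singular vectors. -/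
theorem exists_singular_notMem_polarPerp (hQ : IsNonsingularQuadric Q)
    {α : Submodule (ZMod 2) V} (hα : LiesOn Q α) (h : α ≠ ⊥) :
    ∃ v, Q v = 0 ∧ v ∉ polarPerp Q α := by
  obtain ⟨a, ha, ha0⟩ := Submodule.exists_mem_ne_zero_of_ne_bot h
  have h1 : a ∉ Q.radical := by rw [hQ]; exact ha0
  rw [QuadraticMap.mem_radical_iff'] at h1
  push Not at h1
  obtain ⟨y, hy⟩ := h1 (hα a ha)
  rw [QuadraticMap.map_add Q, hα a ha, zero_add] at hy
  have hay : polar Q a y ≠ 0 := fun h0 => hy (by rw [h0, add_zero])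
  have hay1 := (zmod_two_eq_zero_or_one (polar Q a y)).resolve_left hay
  rcases zmod_two_eq_zero_or_one (Q y) with h0 | h0
  · exact ⟨y, h0, fun h2 => hay (h2 a ha)⟩
  · refine ⟨a + y, ?_, fun h2 => hay ?_⟩
    · rw [QuadraticMap.map_add Q, hα a ha, h0, hay1]; rfl
    · have := mem_polarPerp.1 h2 a ha
      rwa [polar_add_right, polar_self_eq_zero, zero_add] at this

variable [FiniteDimensional (ZMod 2) V]

theorem finite_of_finiteDimensional_zmod_two (V : Type*) [AddCommGroup V] [Module (ZMod 2) V]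
    [FiniteDimensional (ZMod 2) V] : Finite V :=
  Module.finite_of_finite (ZMod 2)

theorem ncard_submodule (W : Submodule (ZMod 2) V) :
    (W : Set V).ncard = 2 ^ finrank (ZMod 2) W := by
  have := Module.natCard_eq_pow_finrank (K := ZMod 2) (V := W)
  rw [Nat.card_zmod] at this
  exact this

theorem finrank_sup_span_singleton {W : Submodule (ZMod 2) V} {v : V} (hv : v ∉ W) :
    finrank (ZMod 2) ↥(W ⊔ Submodule.span (ZMod 2) {v}) = finrank (ZMod 2) W + 1 := by
  have h0 : v ≠ 0 := fun h => hv (h ▸ W.zero_mem)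
  have h := Submodule.finrank_sup_add_finrank_inf_eq W (Submodule.span (ZMod 2) {v})
  have h1 : W ⊓ Submodule.span (ZMod 2) {v} = ⊥ :=
    ((Submodule.disjoint_span_singleton' h0).2 hv).eq_bot
  rw [h1, finrank_bot, finrank_span_singleton h0] at h
  omega

/-- A generator contains every singular vector orthogonal to it. -/
theorem mem_of_finrank_eq {g : ℕ} (hg : IsProjectiveIndex Q g) {G : Submodule (ZMod 2) V}
    (hG : LiesOn Q G) (hGg : finrank (ZMod 2) G = g + 1) {v : V} (hv : Q v = 0)
    (h : v ∈ polarPerp Q G) : v ∈ G := by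
  by_contra hvG
  have h1 := hg.finrank_le
    (hG.sup (liesOn_span_singleton hv) ((Submodule.span_singleton_le_iff_mem _ _).2 h))
  rw [finrank_sup_span_singleton hvG] at h1
  omega

/-- The polar form pairs `G` with `α`, and `G ∩ α` is in the kernel of the pairing on the side of
`α` because `G` is totally singular; hence `G ∩ α^⊥` has codimension at most
`dim α - dim (G ∩ α)` in `G`. -/
theorem finrank_add_finrank_inf_le (G α : Submodule (ZMod 2) V) (hG : LiesOn Q G) :
    finrank (ZMod 2) G + finrank (ZMod 2) ↥(G ⊓ α) ≤
      finrank (ZMod 2) ↥(G ⊓ polarPerp Q α) + finrank (ZMod 2) α := by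
  let f : G →ₗ[ZMod 2] Dual (ZMod 2) α := Q.polarBilin.domRestrict₁₂ G α
  have h1 := LinearMap.finrank_range_add_finrank_ker f
  have hker : finrank (ZMod 2) (LinearMap.ker f) = finrank (ZMod 2) ↥(G ⊓ polarPerp Q α) := by
    rw [← (Submodule.comapSubtypeEquivOfLe (inf_le_left : G ⊓ polarPerp Q α ≤ G)).finrank_eq]
    suffices h : LinearMap.ker f = (G ⊓ polarPerp Q α).comap G.subtype by rw [h]
    ext x
    simp only [LinearMap.mem_ker, Submodule.mem_comap, Submodule.mem_inf, Submodule.subtype_apply,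
      SetLike.coe_mem, true_and, mem_polarPerp]
    constructor
    · intro hx w hw
      rw [polar_comm]
      exact LinearMap.congr_fun hx ⟨w, hw⟩
    · intro hx
      ext w
      exact (polar_comm Q x w).trans (hx w w.2)
  have hrange : LinearMap.range f ≤ (Submodule.comap α.subtype G).dualAnnihilator := by
    rintro _ ⟨x, rfl⟩
    rw [Submodule.mem_dualAnnihilator]
    exact fun w hw => hG.polar_eq_zero x.2 hw
  have h2 := Submodule.finrank_mono hrange
  have h3 := Subspace.finrank_add_finrank_dualAnnihilator_eq (Submodule.comap α.subtype G)
  have h4 : finrank (ZMod 2) (Submodule.comap α.subtype G) = finrank (ZMod 2) ↥(G ⊓ α) := by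
    rw [← (Submodule.comapSubtypeEquivOfLe (inf_le_right : G ⊓ α ≤ α)).finrank_eq]
    suffices h : G.comap α.subtype = (G ⊓ α).comap α.subtype by rw [h]
    ext x
    simp
  omega

/-- Every totally singular subspace lies in a generator: for any generator `G`, the subspace
`(G ∩ α^⊥) + α` is one. -/
theorem exists_le_finrank_eq {g : ℕ} (hg : IsProjectiveIndex Q g) {α : Submodule (ZMod 2) V}
    (hα : LiesOn Q α) : ∃ G, α ≤ G ∧ LiesOn Q G ∧ finrank (ZMod 2) G = g + 1 := by
  obtain ⟨G, hG, hGg⟩ := hg.1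
  have hl : LiesOn Q (α ⊔ G ⊓ polarPerp Q α) :=
    hα.sup (fun v hv => hG v hv.1) inf_le_right
  refine ⟨_, le_sup_left, hl, le_antisymm (hg.finrank_le hl) ?_⟩
  have h1 := finrank_add_finrank_inf_le G α hG
  have h2 := Submodule.finrank_sup_add_finrank_inf_eq α (G ⊓ polarPerp Q α)
  have h3 := Submodule.finrank_mono
    (show α ⊓ (G ⊓ polarPerp Q α) ≤ G ⊓ α from fun v hv => ⟨hv.2.1, hv.1⟩)
  omega

/-- A generator `G` meets `α^⊥` outside `α` unless `α` is itself a generator. -/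
theorem exists_mem_polarPerp_notMem {G α : Submodule (ZMod 2) V} (hG : LiesOn Q G)
    (h : finrank (ZMod 2) α < finrank (ZMod 2) G) : ∃ v ∈ G, v ∈ polarPerp Q α ∧ v ∉ α := by
  by_contra! hc
  have h1 := finrank_add_finrank_inf_le G α hG
  have h2 := Submodule.finrank_mono
    (show G ⊓ polarPerp Q α ≤ G ⊓ α from fun v hv => ⟨hv.1, hc v hv.1 hv.2⟩)
  omega

end TotallySingular

/-! ### Maximum cliques of the switched graph -/

section SwitchedCliques

open Module QuadraticMap

variable {V : Type*} [AddCommGroup V] [Module (ZMod 2) V] {Q : QuadraticForm (ZMod 2) V}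
  {α : Submodule (ZMod 2) V}

/-- The set `C` of nonzero singular vectors is a clique of the switched graph, expressed through
the polar form: two elements of `C` are orthogonal, unless one of them lies in `α^⊥ \ α` and the
other one outside `α^⊥`. -/
structure IsSwitchedClique (Q : QuadraticForm (ZMod 2) V) (α : Submodule (ZMod 2) V)
    (C : Set V) : Prop where
  ne_zero : ∀ x ∈ C, x ≠ 0
  singular : ∀ x ∈ C, Q x = 0
  polar_eq_zero_left : ∀ x ∈ C, ∀ y ∈ C, x ∈ α → polar Q x y = 0
  polar_eq_zero_mem : ∀ x ∈ C, ∀ y ∈ C, x ∈ polarPerp Q α → y ∈ polarPerp Q α → polar Q x y = 0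
  polar_eq_zero_notMem :
    ∀ x ∈ C, ∀ y ∈ C, x ∉ polarPerp Q α → y ∉ polarPerp Q α → polar Q x y = 0
  polar_eq_one :
    ∀ x ∈ C, ∀ y ∈ C, x ∈ polarPerp Q α → x ∉ α → y ∉ polarPerp Q α → polar Q x y = 1

variable [FiniteDimensional (ZMod 2) V]

/-- A large set of pairwise orthogonal nonzero singular vectors is the set of nonzero vectors of a
generator. -/
theorem exists_generator_of_pairwise_polar_eq_zero {g : ℕ} (hg : IsProjectiveIndex Q g)
    {C : Set V} (hne : ∀ x ∈ C, x ≠ 0) (h0 : ∀ x ∈ C, Q x = 0)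
    (h : ∀ x ∈ C, ∀ y ∈ C, polar Q x y = 0) (hC : 2 ^ (g + 1) ≤ C.ncard + 1) :
    ∃ G : Submodule (ZMod 2) V, LiesOn Q G ∧ finrank (ZMod 2) G = g + 1 ∧ C = (G : Set V) \ {0} := by
  have := finite_of_finiteDimensional_zmod_two V
  have hl := liesOn_span h0 h
  set G := Submodule.span (ZMod 2) C
  have hsub : C ⊆ (G : Set V) \ {0} := fun x hx => ⟨Submodule.subset_span hx, hne x hx⟩
  have hcard : ((G : Set V) \ {0}).ncard + 1 = 2 ^ finrank (ZMod 2) G := by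
    rw [← ncard_submodule]
    exact Set.ncard_sdiff_singleton_add_one G.zero_mem
  have h1 := Set.ncard_le_ncard hsub
  have h2 := hg.finrank_le hl
  have h3 := Nat.pow_le_pow_right (n := 2) (by norm_num) h2
  refine ⟨G, hl, le_antisymm h2 ?_, Set.eq_of_subset_of_ncard_le hsub (by omega)⟩
  exact (Nat.pow_le_pow_iff_right (le_refl 2)).1 (by omega)

theorem ncard_inter_submodule_add_one_le {C : Set V} (hne : ∀ x ∈ C, x ≠ 0)
    (W : Submodule (ZMod 2) V) : (C ∩ W).ncard + 1 ≤ 2 ^ finrank (ZMod 2) W := by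
  have := finite_of_finiteDimensional_zmod_two V
  rw [← ncard_submodule, ← Set.ncard_sdiff_singleton_add_one (W.zero_mem)]
  have hsub : C ∩ W ⊆ (W : Set V) \ {0} := fun x hx => ⟨hx.2, hne x hx.1⟩
  exact Nat.add_le_add_right (Set.ncard_le_ncard hsub) 1

theorem ncard_le_of_add_mem {D : Set V} (x₀ : V) (W : Submodule (ZMod 2) V)
    (h : ∀ x ∈ D, x₀ + x ∈ W) : D.ncard ≤ 2 ^ finrank (ZMod 2) W := by
  have := finite_of_finiteDimensional_zmod_two V
  rw [← ncard_submodule, ← Set.ncard_image_of_injective D (add_right_injective x₀)]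
  exact Set.ncard_le_ncard (by rintro _ ⟨x, hx, rfl⟩; exact h x hx)

theorem finrank_inf_lt {U W : Submodule (ZMod 2) V} (h : ¬ U ≤ W) :
    finrank (ZMod 2) ↥(U ⊓ W) < finrank (ZMod 2) U :=
  Submodule.finrank_lt_finrank_of_lt (lt_of_le_of_ne inf_le_left fun h' => h (inf_eq_left.1 h'))

/-- A maximum clique of the switched graph that meets both `α^⊥ \ α` and the complement of `α^⊥`
has `2 ^ s - 1` points in `α` and `2 ^ g - 2 ^ s` points in `α^⊥ \ α`. The differences of elements
of the clique in the same part, together with its elements in `α`, span a totally singular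
subspace `U` of dimension at most `g`; each part of the clique lies in a coset of `U`. -/
theorem IsSwitchedClique.ncard_inter {g s : ℕ} (hg : IsProjectiveIndex Q g) (hsg : s < g)
    (hα : LiesOn Q α) (hαs : finrank (ZMod 2) α = s + 1) {C : Set V}
    (hC : IsSwitchedClique Q α C) (hcard : 2 ^ (g + 1) ≤ C.ncard + 1)
    {x₀ r₀ : V} (hx₀ : x₀ ∈ C) (hx₀' : x₀ ∈ polarPerp Q α) (hx₀α : x₀ ∉ α)
    (hr₀ : r₀ ∈ C) (hr₀' : r₀ ∉ polarPerp Q α) :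
    (C ∩ α).ncard + 1 = 2 ^ s ∧
      (C ∩ {v | v ∈ polarPerp Q α ∧ v ∉ α}).ncard + 2 ^ s = 2 ^ g := by
  have := finite_of_finiteDimensional_zmod_two V
  have hαα : α ≤ polarPerp Q α := fun a ha b hb => hα.polar_eq_zero hb ha
  -- The three parts of the clique.
  set Ca := C ∩ α with hCa
  set Cx := C ∩ {v | v ∈ polarPerp Q α ∧ v ∉ α} with hCx
  set Cr := C \ polarPerp Q α with hCr
  have hsum : C.ncard = Ca.ncard + Cx.ncard + Cr.ncard := by
    rw [← Set.ncard_inter_add_ncard_sdiff_eq_ncard C (polarPerp Q α),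
      ← Set.ncard_inter_add_ncard_sdiff_eq_ncard (C ∩ polarPerp Q α) α]
    congr 3
    · ext v
      simp only [hCa, Set.mem_inter_iff, SetLike.mem_coe]
      exact ⟨fun h => ⟨h.1.1, h.2⟩, fun h => ⟨⟨h.1, hαα h.2⟩, h.2⟩⟩
    · ext v
      simp only [hCx, Set.mem_inter_iff, Set.mem_sdiff, SetLike.mem_coe, Set.mem_ofPred_eq]
      tauto
  have hxr := hC.polar_eq_one x₀ hx₀ r₀ hr₀ hx₀' hx₀α hr₀'
  -- The generators of `U` are orthogonal to the whole clique.
  set D : Set V := Ca ∪ ((x₀ + ·) '' Cx ∪ (r₀ + ·) '' Cr) with hD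
  have hDC : ∀ d ∈ D, ∀ y ∈ C, polar Q d y = 0 := by
    rintro d (hd | ⟨x, hx, rfl⟩ | ⟨r, hr, rfl⟩) y hy
    · exact hC.polar_eq_zero_left d hd.1 y hy hd.2
    · rw [polar_add_left]
      by_cases hy' : y ∈ polarPerp Q α
      · rw [hC.polar_eq_zero_mem x₀ hx₀ y hy hx₀' hy',
          hC.polar_eq_zero_mem x hx.1 y hy hx.2.1 hy', add_zero]
      · rw [hC.polar_eq_one x₀ hx₀ y hy hx₀' hx₀α hy',
          hC.polar_eq_one x hx.1 y hy hx.2.1 hx.2.2 hy']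
        rfl
    · rw [polar_add_left]
      by_cases hy' : y ∈ polarPerp Q α
      · by_cases hyα : y ∈ α
        · rw [polar_comm, hC.polar_eq_zero_left y hy r₀ hr₀ hyα, polar_comm,
            hC.polar_eq_zero_left y hy r hr.1 hyα, add_zero]
        · rw [polar_comm, hC.polar_eq_one y hy r₀ hr₀ hy' hyα hr₀', polar_comm,
            hC.polar_eq_one y hy r hr.1 hy' hyα hr.2]
          rfl
      · rw [hC.polar_eq_zero_notMem r₀ hr₀ y hy hr₀' hy',
          hC.polar_eq_zero_notMem r hr.1 y hy hr.2 hy', add_zero]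
  have hD0 : ∀ d ∈ D, Q d = 0 := by
    rintro d (hd | ⟨x, hx, rfl⟩ | ⟨r, hr, rfl⟩)
    · exact hC.singular d hd.1
    · simp only
      rw [QuadraticMap.map_add Q, hC.singular x₀ hx₀, hC.singular x hx.1,
        hC.polar_eq_zero_mem x₀ hx₀ x hx.1 hx₀' hx.2.1, add_zero, add_zero]
    · simp only
      rw [QuadraticMap.map_add Q, hC.singular r₀ hr₀, hC.singular r hr.1,
        hC.polar_eq_zero_notMem r₀ hr₀ r hr.1 hr₀' hr.2, add_zero, add_zero]
  have hDD : ∀ d ∈ D, ∀ e ∈ D, polar Q d e = 0 := by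
    rintro d hd e (he | ⟨x, hx, rfl⟩ | ⟨r, hr, rfl⟩)
    · exact hDC d hd e he.1
    · rw [polar_add_right, hDC d hd x₀ hx₀, hDC d hd x hx.1, add_zero]
    · rw [polar_add_right, hDC d hd r₀ hr₀, hDC d hd r hr.1, add_zero]
  have hU : LiesOn Q (Submodule.span (ZMod 2) D) := liesOn_span hD0 hDD
  have hUC : ∀ y ∈ C, ∀ u ∈ Submodule.span (ZMod 2) D, polar Q u y = 0 := by
    intro y hy
    have : Submodule.span (ZMod 2) D ≤ LinearMap.ker (Q.polarBilin y) :=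
      Submodule.span_le.2 fun d hd => (polar_comm Q y d).trans (hDC d hd y hy)
    exact fun u hu => (polar_comm Q u y).trans (this hu)
  have hCaU : Ca ⊆ Submodule.span (ZMod 2) D := fun a ha => Submodule.subset_span (Or.inl ha)
  have hCxU : ∀ x ∈ Cx, x₀ + x ∈ Submodule.span (ZMod 2) D := fun x hx =>
    Submodule.subset_span (Or.inr (Or.inl ⟨x, hx, rfl⟩))
  have hCrU : ∀ r ∈ Cr, r₀ + r ∈ Submodule.span (ZMod 2) D := fun r hr =>
    Submodule.subset_span (Or.inr (Or.inr ⟨r, hr, rfl⟩))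
  generalize Submodule.span (ZMod 2) D = U at hU hUC hCaU hCxU hCrU
  -- The subspace `U + x₀` is totally singular, and `x₀ ∉ U` because `U ⊥ r₀`.
  have hx₀U : x₀ ∉ U := fun h => by
    have := hUC r₀ hr₀ x₀ h
    rw [hxr] at this
    exact one_ne_zero this
  have hG : LiesOn Q (U ⊔ Submodule.span (ZMod 2) {x₀}) :=
    hU.sup (liesOn_span_singleton (hC.singular x₀ hx₀))
      ((Submodule.span_singleton_le_iff_mem _ _).2 (hUC x₀ hx₀))
  have hGr := finrank_sup_span_singleton hx₀U
  have hGg := hg.finrank_le hG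
  have hαU : ¬ α ≤ U := fun h => hr₀' fun a ha => hUC r₀ hr₀ a (h ha)
  have hCaα : Ca ⊆ C ∩ ↑(α ⊓ U : Submodule (ZMod 2) V) := fun a ha => ⟨ha.1, ha.2, hCaU ha⟩
  have hCa1 := (Nat.add_le_add_right (Set.ncard_le_ncard hCaα) 1).trans
    (ncard_inter_submodule_add_one_le hC.ne_zero (α ⊓ U))
  have hαUr := finrank_inf_lt hαU
  have hCx1 := ncard_le_of_add_mem x₀ U hCxU
  have hCr1 := ncard_le_of_add_mem r₀ U hCrU
  have hs1 : 2 ^ (s + 1) ≤ 2 ^ g := Nat.pow_le_pow_right (by norm_num) hsg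
  have hUle := Submodule.finrank_mono (inf_le_right : α ⊓ U ≤ U)
  have hUg : finrank (ZMod 2) U = g := by
    by_contra hne
    obtain ⟨k, rfl⟩ : ∃ k, g = k + 1 := ⟨g - 1, by omega⟩
    have h1 : 2 ^ finrank (ZMod 2) U ≤ 2 ^ k := Nat.pow_le_pow_right (by norm_num) (by omega)
    have h2 := Nat.pow_le_pow_right (n := 2) (by norm_num) hUle
    rw [pow_succ, pow_succ] at hcard
    omega
  rw [hUg] at hCx1 hCr1 hGr
  rw [pow_succ] at hcard hs1
  by_cases hUα : U ≤ polarPerp Q α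
  · -- The generator `U + x₀` lies in `α^⊥`, so it contains `α`.
    have hGα : α ≤ U ⊔ Submodule.span (ZMod 2) {x₀} := by
      intro a ha
      refine mem_of_finrank_eq hg hG hGr (hα a ha) ?_
      have : U ⊔ Submodule.span (ZMod 2) {x₀} ≤ polarPerp Q α :=
        sup_le hUα ((Submodule.span_singleton_le_iff_mem _ _).2 hx₀')
      exact fun w hw => (polar_comm Q w a).trans (this hw a ha)
    have h1 := Submodule.finrank_sup_add_finrank_inf_eq α U
    have h2 := Submodule.finrank_mono (sup_le hGα le_sup_left)
    have h3 : finrank (ZMod 2) ↥(α ⊓ U) = s := by omega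
    rw [h3] at hCa1
    -- A coset of `α ∩ U` in `x₀ + U` lies in `α` and is avoided by the clique.
    obtain ⟨p, hpα, hpU⟩ := SetLike.not_le_iff_exists.1 hαU
    have hpx : x₀ + p ∈ U := by
      obtain ⟨u, hu, w, hw, hp⟩ := Submodule.mem_sup.1 (hGα hpα)
      obtain ⟨c, rfl⟩ := Submodule.mem_span_singleton.1 hw
      rcases zmod_two_eq_zero_or_one c with rfl | rfl
      · rw [zero_smul, add_zero] at hp
        exact absurd (hp ▸ hu) hpU
      · rw [one_smul] at hp
        rwa [← hp, add_comm u, add_add_self_zmod_two]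
    have hdisj : Disjoint Cx ((p + ·) '' ((α ⊓ U : Submodule (ZMod 2) V) : Set V)) := by
      rw [Set.disjoint_left]
      rintro _ hx ⟨u, hu, rfl⟩
      exact hx.2.2 (α.add_mem hpα hu.1)
    have h4 := ncard_le_of_add_mem (D := Cx ∪ (p + ·) '' ((α ⊓ U : Submodule (ZMod 2) V) : Set V))
      x₀ U (by
        rintro _ (hx | ⟨u, hu, rfl⟩)
        · exact hCxU _ hx
        · simp only
          rw [← add_assoc]
          exact U.add_mem hpx hu.2)
    rw [Set.ncard_union_eq hdisj, Set.ncard_image_of_injective _ (add_right_injective p),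
      ncard_submodule, h3, hUg] at h4
    omega
  · -- Now `U ∩ α^⊥` has index two in `U`; counting forces `s = g - 1`.
    have h1 := finrank_inf_lt hUα
    have h2 := ncard_le_of_add_mem (D := Cx) x₀ (U ⊓ polarPerp Q α) fun x hx =>
      ⟨hCxU x hx, Submodule.add_mem _ hx₀' hx.2.1⟩
    have h3 := Submodule.finrank_mono
      (show α ⊓ U ≤ U ⊓ polarPerp Q α from fun v hv => ⟨hv.2, hαα hv.1⟩)
    obtain ⟨k, rfl⟩ : ∃ k, g = k + 1 := ⟨g - 1, by omega⟩
    have h4 : 2 ^ finrank (ZMod 2) ↥(U ⊓ polarPerp Q α) ≤ 2 ^ k :=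
      Nat.pow_le_pow_right (by norm_num) (by omega)
    have h5 : 2 ^ finrank (ZMod 2) ↥(α ⊓ U) ≤ 2 ^ s :=
      Nat.pow_le_pow_right (by norm_num) (by omega)
    have h6 : 2 ^ s ≤ 2 ^ k := Nat.pow_le_pow_right (by norm_num) (by omega)
    have h7 : 2 ^ finrank (ZMod 2) ↥(α ⊓ U) ≤ 2 ^ finrank (ZMod 2) ↥(U ⊓ polarPerp Q α) :=
      Nat.pow_le_pow_right (by norm_num) h3
    rw [pow_succ] at hcard hs1 hCr1 ⊢
    omega

/-- A maximum clique of the switched graph either contains `α` and lies in `α^⊥`, or it meets `α`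
in `2 ^ s - 1` points and `α^⊥ \ α` in `2 ^ g - 2 ^ s` points. -/
theorem IsSwitchedClique.le_or_ncard_inter {g s : ℕ} (hg : IsProjectiveIndex Q g) (hsg : s < g)
    (hα : LiesOn Q α) (hαs : finrank (ZMod 2) α = s + 1) {C : Set V}
    (hC : IsSwitchedClique Q α C) (hcard : 2 ^ (g + 1) ≤ C.ncard + 1) :
    ((∀ a ∈ α, a ≠ 0 → a ∈ C) ∧ C ⊆ polarPerp Q α) ∨
      ((C ∩ α).ncard + 1 = 2 ^ s ∧
        (C ∩ {v | v ∈ polarPerp Q α ∧ v ∉ α}).ncard + 2 ^ s = 2 ^ g) := by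
  by_cases hr : C ⊆ polarPerp Q α
  · left
    obtain ⟨G, hG, hGg, rfl⟩ := exists_generator_of_pairwise_polar_eq_zero hg hC.ne_zero
      hC.singular (fun x hx y hy => hC.polar_eq_zero_mem x hx y hy (hr hx) (hr hy)) hcard
    refine ⟨fun a ha ha0 => ⟨mem_of_finrank_eq hg hG hGg (hα a ha) fun w hw => ?_, ha0⟩, hr⟩
    by_cases hw0 : w = 0
    · change polar Q w a = 0
      rw [hw0, polar_zero_left]
    · exact (polar_comm Q w a).trans (hr ⟨hw, hw0⟩ a ha)
  · right
    obtain ⟨r₀, hr₀, hr₀'⟩ := Set.not_subset.1 hr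
    by_cases hx : ∃ x ∈ C, x ∈ polarPerp Q α ∧ x ∉ α
    · obtain ⟨x₀, hx₀, hx₀', hx₀α⟩ := hx
      exact hC.ncard_inter hg hsg hα hαs hcard hx₀ hx₀' hx₀α hr₀ hr₀'
    · -- The clique would be a generator missing `α^⊥ \ α`, which is impossible.
      exfalso
      push Not at hx
      have hort : ∀ x ∈ C, ∀ y ∈ C, polar Q x y = 0 := by
        intro x hxC y hyC
        by_cases hxα : x ∈ α
        · exact hC.polar_eq_zero_left x hxC y hyC hxα
        by_cases hyα : y ∈ α
        · rw [polar_comm]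
          exact hC.polar_eq_zero_left y hyC x hxC hyα
        exact hC.polar_eq_zero_notMem x hxC y hyC (fun h => hxα (hx x hxC h))
          (fun h => hyα (hx y hyC h))
      obtain ⟨G, hG, hGg, rfl⟩ := exists_generator_of_pairwise_polar_eq_zero hg hC.ne_zero
        hC.singular hort hcard
      obtain ⟨v, hvG, hv, hvα⟩ := exists_mem_polarPerp_notMem (α := α) hG (by omega)
      exact hvα (hx v ⟨hvG, fun h => hvα (h ▸ α.zero_mem)⟩ hv)

end SwitchedCliques

/-! ### The switched graph in terms of vectors -/

section SwitchedGraph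

open Module QuadraticMap

variable {V : Type*} [AddCommGroup V] [Module (ZMod 2) V] {Q : QuadraticForm (ZMod 2) V}
  {α : Submodule (ZMod 2) V}

/-- The nonzero vector spanning a point of the quadric; it is unique over `GF(2)`. -/
noncomputable def singularVector (P : QuadricPoint Q) : V := P.1.rep

theorem singularVector_ne_zero (P : QuadricPoint Q) : singularVector P ≠ 0 := P.1.rep_nonzero

theorem submodule_eq_span_singularVector (P : QuadricPoint Q) :
    P.1.submodule = Submodule.span (ZMod 2) {singularVector P} := P.1.submodule_eq

theorem submodule_le_iff_singularVector_mem {P : QuadricPoint Q} {W : Submodule (ZMod 2) V} :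
    P.1.submodule ≤ W ↔ singularVector P ∈ W := by
  rw [submodule_eq_span_singularVector, Submodule.span_singleton_le_iff_mem]

theorem map_singularVector (P : QuadricPoint Q) : Q (singularVector P) = 0 :=
  P.2 _ (submodule_le_iff_singularVector_mem.1 le_rfl)

theorem singularVector_injective : Function.Injective (singularVector (Q := Q)) := by
  intro P P' h
  refine Subtype.ext (Projectivization.submodule_injective ?_)
  rw [submodule_eq_span_singularVector, submodule_eq_span_singularVector, h]

theorem exists_singularVector_eq {v : V} (h0 : v ≠ 0) (hv : Q v = 0) :
    ∃ P : QuadricPoint Q, singularVector P = v := by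
  refine ⟨⟨Projectivization.mk (ZMod 2) v h0, ?_⟩, ?_⟩
  · rw [Projectivization.submodule_mk]
    exact liesOn_span_singleton hv
  · obtain ⟨a, ha⟩ := Projectivization.exists_smul_eq_mk_rep (ZMod 2) v h0
    rw [Subsingleton.elim a 1, one_smul] at ha
    exact ha.symm

theorem image_singularVector (p : V → Prop) :
    singularVector (Q := Q) '' {P | p (singularVector P)} = {v | v ≠ 0 ∧ Q v = 0 ∧ p v} := by
  ext v
  constructor
  · rintro ⟨P, hP, rfl⟩
    exact ⟨singularVector_ne_zero P, map_singularVector P, hP⟩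
  · rintro ⟨h0, hv, hp⟩
    obtain ⟨P, rfl⟩ := exists_singularVector_eq h0 hv
    exact ⟨P, hp, rfl⟩

theorem ncard_setOf_singularVector (p : V → Prop) :
    {P : QuadricPoint Q | p (singularVector P)}.ncard = {v | v ≠ 0 ∧ Q v = 0 ∧ p v}.ncard := by
  rw [← image_singularVector, Set.ncard_image_of_injective _ singularVector_injective]

theorem ncard_image_singularVector_inter (C : Set (QuadricPoint Q)) (p : V → Prop) :
    (singularVector '' C ∩ {v | p v}).ncard = (C ∩ {P | p (singularVector P)}).ncard := by
  rw [← Set.ncard_image_of_injective (C ∩ _) singularVector_injective]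
  congr 1
  ext v
  constructor
  · rintro ⟨⟨P, hP, rfl⟩, hp⟩
    exact ⟨P, ⟨hP, hp⟩, rfl⟩
  · rintro ⟨P, ⟨hP, hp⟩, rfl⟩
    exact ⟨⟨P, hP, rfl⟩, hp⟩

theorem pointGraph_adj_iff {P P' : QuadricPoint Q} :
    (pointGraph Q).Adj P P' ↔ P ≠ P' ∧ polar Q (singularVector P) (singularVector P') = 0 := by
  refine and_congr_right fun _ => ⟨fun h => ?_, fun h => ?_⟩
  · exact h.polar_eq_zero
      (submodule_le_iff_singularVector_mem.1 le_sup_left)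
      (submodule_le_iff_singularVector_mem.1 le_sup_right)
  · refine P.2.sup P'.2 (submodule_le_iff_singularVector_mem.2 fun w hw => ?_)
    rw [submodule_eq_span_singularVector] at hw
    obtain ⟨c, rfl⟩ := Submodule.mem_span_singleton.1 hw
    change polar Q _ _ = 0
    rw [polar_smul_left, h, smul_zero]

/-- Translation by a vector of `α` preserves the set of singular vectors in `α^⊥ \ α`. -/
theorem add_mem_polarPerp_notMem (hα : LiesOn Q α) {p v : V} (hp : p ∈ α) (hQv : Q v = 0)
    (hv : v ∈ polarPerp Q α) (hvα : v ∉ α) :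
    p + v ≠ 0 ∧ Q (p + v) = 0 ∧ p + v ∈ polarPerp Q α ∧ p + v ∉ α := by
  have hpv : p + v ∉ α := fun h => hvα ((Submodule.add_mem_iff_right α hp).1 h)
  refine ⟨fun h => hpv (h ▸ α.zero_mem), ?_, Submodule.add_mem _
    (fun a ha => hα.polar_eq_zero ha hp) hv, hpv⟩
  rw [QuadraticMap.map_add Q, hα p hp, hQv, mem_polarPerp.1 hv p hp, add_zero, add_zero]

variable [FiniteDimensional (ZMod 2) V]

theorem finite_quadricPoint (Q : QuadraticForm (ZMod 2) V) : Finite (QuadricPoint Q) := by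
  have := finite_of_finiteDimensional_zmod_two V
  exact Finite.of_injective _ (singularVector_injective (Q := Q))

theorem mem_typeTwoPoints_iff (hα : LiesOn Q α) {P : QuadricPoint Q} :
    P ∈ typeTwoPoints Q α ↔ singularVector P ∈ polarPerp Q α ∧ singularVector P ∉ α := by
  constructor
  · rintro ⟨h1, W, hαW, hW, -, hP⟩
    exact ⟨fun a ha => hW.polar_eq_zero (hαW ha) (submodule_le_iff_singularVector_mem.1 hP),
      fun h => h1 (submodule_le_iff_singularVector_mem.2 h)⟩
  · rintro ⟨h1, h2⟩
    refine ⟨fun h => h2 (submodule_le_iff_singularVector_mem.1 h),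
      α ⊔ Submodule.span (ZMod 2) {singularVector P}, le_sup_left, ?_,
      finrank_sup_span_singleton h2, ?_⟩
    · exact hα.sup (liesOn_span_singleton (map_singularVector P))
        ((Submodule.span_singleton_le_iff_mem _ _).2 h1)
    · rw [submodule_eq_span_singularVector]
      exact le_sup_right

/-- A point outside `α^⊥` is adjacent to exactly half of the points of `α^⊥ \ α`: translation by a
vector of `α` not orthogonal to it exchanges neighbours and non-neighbours. -/
theorem halfAdjacent_of_notMem_polarPerp (hα : LiesOn Q α) {R : QuadricPoint Q}
    (hR : singularVector R ∉ polarPerp Q α) :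
    HalfAdjacent (pointGraph Q) (typeTwoPoints Q α) R := by
  have := finite_of_finiteDimensional_zmod_two V
  have := finite_quadricPoint Q
  have hRX : R ∉ typeTwoPoints Q α := fun h => hR ((mem_typeTwoPoints_iff hα).1 h).1
  refine ⟨hRX, ?_⟩
  obtain ⟨p, hp, hpR⟩ : ∃ p ∈ α, polar Q p (singularVector R) ≠ 0 := by
    by_contra! h
    exact hR h
  have hpR1 := (zmod_two_eq_zero_or_one _).resolve_left hpR
  have h1 := Set.ncard_inter_add_ncard_sdiff_eq_ncard (typeTwoPoints Q α)
    ((pointGraph Q).neighborSet R)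
  have hN : typeTwoPoints Q α ∩ (pointGraph Q).neighborSet R =
      {P | (singularVector P ∈ polarPerp Q α ∧ singularVector P ∉ α) ∧
        polar Q (singularVector P) (singularVector R) = 0} := by
    ext P
    rw [Set.mem_inter_iff, mem_typeTwoPoints_iff hα, SimpleGraph.mem_neighborSet,
      pointGraph_adj_iff, polar_comm]
    refine and_congr_right fun hP => ⟨fun h => h.2, fun h => ⟨?_, h⟩⟩
    rintro rfl
    exact hR hP.1
  have hM : typeTwoPoints Q α \ (pointGraph Q).neighborSet R =
      {P | (singularVector P ∈ polarPerp Q α ∧ singularVector P ∉ α) ∧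
        polar Q (singularVector P) (singularVector R) ≠ 0} := by
    ext P
    rw [Set.mem_sdiff, mem_typeTwoPoints_iff hα, SimpleGraph.mem_neighborSet,
      pointGraph_adj_iff, polar_comm]
    refine and_congr_right fun hP => not_congr ⟨fun h => h.2, fun h => ⟨?_, h⟩⟩
    rintro rfl
    exact hR hP.1
  rw [Set.inter_comm]
  rw [hN, hM] at h1
  rw [hN]
  suffices h : {P : QuadricPoint Q |
      (singularVector P ∈ polarPerp Q α ∧ singularVector P ∉ α) ∧
        polar Q (singularVector P) (singularVector R) ≠ 0}.ncard =
      {P : QuadricPoint Q | (singularVector P ∈ polarPerp Q α ∧ singularVector P ∉ α) ∧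
        polar Q (singularVector P) (singularVector R) = 0}.ncard by omega
  rw [ncard_setOf_singularVector
      (fun v => (v ∈ polarPerp Q α ∧ v ∉ α) ∧ polar Q v (singularVector R) ≠ 0),
    ncard_setOf_singularVector
      (fun v => (v ∈ polarPerp Q α ∧ v ∉ α) ∧ polar Q v (singularVector R) = 0),
    ← Set.ncard_image_of_injective _ (add_right_injective p)]
  congr 1
  ext w
  constructor
  · rintro ⟨v, ⟨-, hQv, ⟨hv, hvα⟩, hvR⟩, rfl⟩
    obtain ⟨k1, k2, k3, k4⟩ := add_mem_polarPerp_notMem hα hp hQv hv hvα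
    refine ⟨k1, k2, ⟨k3, k4⟩, ?_⟩
    simp only
    rw [polar_add_left, hpR1, (zmod_two_eq_zero_or_one _).resolve_left hvR]
    rfl
  · rintro ⟨-, hQv, ⟨hv, hvα⟩, hvR⟩
    obtain ⟨k1, k2, k3, k4⟩ := add_mem_polarPerp_notMem hα hp hQv hv hvα
    refine ⟨p + w, ⟨k1, k2, ⟨k3, k4⟩, ?_⟩, add_add_self_zmod_two p w⟩
    rwa [polar_add_left, hvR, add_zero]

/-- Adjacency is switched exactly between `α^⊥ \ α` and the complement of `α^⊥`, since a point of
`α` is adjacent to all points of `α^⊥ \ α`. -/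
theorem isSwitchedPair_iff (hα : LiesOn Q α) {P R : QuadricPoint Q} :
    IsSwitchedPair (pointGraph Q) (typeTwoPoints Q α) P R ↔
      ((singularVector P ∈ polarPerp Q α ∧ singularVector P ∉ α) ∧
          singularVector R ∉ polarPerp Q α) ∨
        ((singularVector R ∈ polarPerp Q α ∧ singularVector R ∉ α) ∧
          singularVector P ∉ polarPerp Q α) := by
  have := finite_quadricPoint Q
  have key : ∀ P R : QuadricPoint Q, P ∈ typeTwoPoints Q α →
      (HalfAdjacent (pointGraph Q) (typeTwoPoints Q α) R ↔
        singularVector R ∉ polarPerp Q α) := by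
    refine fun P R hP => ⟨fun hR hR' => ?_, halfAdjacent_of_notMem_polarPerp hα⟩
    have hRα : singularVector R ∈ α := by
      by_contra h
      exact hR.1 ((mem_typeTwoPoints_iff hα).2 ⟨hR', h⟩)
    have hN : (pointGraph Q).neighborSet R ∩ typeTwoPoints Q α = typeTwoPoints Q α := by
      refine Set.inter_eq_right.2 fun P' hP' => pointGraph_adj_iff.2 ⟨?_, ?_⟩
      · rintro rfl
        exact hR.1 hP'
      · exact ((mem_typeTwoPoints_iff hα).1 hP').1 _ hRα
    have h := hR.2
    rw [hN] at h
    have h0 : 0 < (typeTwoPoints Q α).ncard := (Set.ncard_pos).2 ⟨P, hP⟩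
    omega
  refine or_congr ?_ ?_ <;>
    exact ⟨fun h => ⟨(mem_typeTwoPoints_iff hα).1 h.1, (key _ _ h.1).1 h.2⟩, fun h =>
      have h1 := (mem_typeTwoPoints_iff hα).2 h.1
      ⟨h1, (key _ _ h1).2 h.2⟩⟩

theorem isSwitchedClique_image (hα : LiesOn Q α) {C : Set (QuadricPoint Q)}
    (hC : (switchedGraph Q α).IsClique C) : IsSwitchedClique Q α (singularVector '' C) := by
  have hαα : α ≤ polarPerp Q α := fun a ha b hb => hα.polar_eq_zero hb ha
  have key : ∀ P ∈ C, ∀ R ∈ C,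
      ¬ IsSwitchedPair (pointGraph Q) (typeTwoPoints Q α) P R →
        polar Q (singularVector P) (singularVector R) = 0 := by
    intro P hP R hR h
    by_cases hPR : P = R
    · rw [hPR, polar_self_eq_zero]
    · rcases hC hP hR hPR with h' | h'
      · exact (pointGraph_adj_iff.1 h'.1).2
      · exact absurd h'.2 h
  refine ⟨?_, ?_, ?_, ?_, ?_, ?_⟩
  · rintro _ ⟨P, -, rfl⟩
    exact singularVector_ne_zero P
  · rintro _ ⟨P, -, rfl⟩
    exact map_singularVector P
  · rintro _ ⟨P, hP, rfl⟩ _ ⟨R, hR, rfl⟩ h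
    refine key P hP R hR fun h' => ?_
    rcases (isSwitchedPair_iff hα).1 h' with h' | h'
    · exact h'.1.2 h
    · exact h'.2 (hαα h)
  · rintro _ ⟨P, hP, rfl⟩ _ ⟨R, hR, rfl⟩ h1 h2
    refine key P hP R hR fun h' => ?_
    rcases (isSwitchedPair_iff hα).1 h' with h' | h'
    · exact h'.2 h2
    · exact h'.2 h1
  · rintro _ ⟨P, hP, rfl⟩ _ ⟨R, hR, rfl⟩ h1 h2
    refine key P hP R hR fun h' => ?_
    rcases (isSwitchedPair_iff hα).1 h' with h' | h'
    · exact h1 h'.1.1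
    · exact h2 h'.1.1
  · rintro _ ⟨P, hP, rfl⟩ _ ⟨R, hR, rfl⟩ h1 h2 h3
    have hs := (isSwitchedPair_iff hα (P := P) (R := R)).2 (Or.inl ⟨⟨h1, h2⟩, h3⟩)
    have hPR : P ≠ R := by
      rintro rfl
      exact h3 h1
    refine (zmod_two_eq_zero_or_one _).resolve_left fun h0 => ?_
    rcases hC hP hR hPR with h' | h'
    · exact h'.2 hs
    · exact h'.1 (pointGraph_adj_iff.2 ⟨hPR, h0⟩)

/-- A generator through `α` is a clique of the switched graph. -/
theorem exists_isClique_switchedGraph {g : ℕ} (hg : IsProjectiveIndex Q g) (hα : LiesOn Q α) :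
    ∃ D : Set (QuadricPoint Q), (switchedGraph Q α).IsClique D ∧ D.ncard + 1 = 2 ^ (g + 1) := by
  have := finite_of_finiteDimensional_zmod_two V
  obtain ⟨G, hαG, hG, hGg⟩ := exists_le_finrank_eq hg hα
  refine ⟨{P | singularVector P ∈ G}, fun P hP R hR hPR => Or.inl ⟨?_, fun h => ?_⟩, ?_⟩
  · exact pointGraph_adj_iff.2 ⟨hPR, hG.polar_eq_zero hP hR⟩
  · have hGα : ∀ v ∈ G, v ∈ polarPerp Q α := fun v hv a ha => hG.polar_eq_zero (hαG ha) hv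
    rcases (isSwitchedPair_iff hα).1 h with h | h
    · exact h.2 (hGα _ hR)
    · exact h.2 (hGα _ hP)
  · have h1 : {v | v ≠ 0 ∧ Q v = 0 ∧ v ∈ G} = (G : Set V) \ {0} := by
      ext v
      exact ⟨fun h => ⟨h.2.2, h.1⟩, fun h => ⟨h.2, hG v h.1, h.1⟩⟩
    rw [ncard_setOf_singularVector (fun v => v ∈ G), h1,
      Set.ncard_sdiff_singleton_add_one G.zero_mem, ncard_submodule, hGg]

/-- If every block of a partition meets `Y` in `m` elements, then `Y` has `m` elements for each
block. -/
theorem Setoid.IsPartition.ncard_eq_mul {U : Type*} [Finite U] {𝒞 : Set (Set U)}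
    (h : Setoid.IsPartition 𝒞) (Y : Set U) (m : ℕ) (hm : ∀ C ∈ 𝒞, (C ∩ Y).ncard = m) :
    Y.ncard = 𝒞.ncard * m := by
  classical
  have hfin := 𝒞.toFinite
  have hY : Y = ⋃ C ∈ hfin.toFinset, C ∩ Y := by
    ext y
    simp only [Set.Finite.mem_toFinset, Set.mem_iUnion, Set.mem_inter_iff, exists_prop]
    constructor
    · intro hy
      obtain ⟨C, ⟨hC, hyC⟩, -⟩ := h.2 y
      exact ⟨C, hC, hyC, hy⟩
    · rintro ⟨C, -, -, hy⟩
      exact hy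
  have hd : (hfin.toFinset : Set (Set U)).PairwiseDisjoint (fun C => C ∩ Y) := by
    intro C hC C' hC' hne
    rw [Set.Finite.coe_toFinset] at hC hC'
    exact (h.pairwiseDisjoint hC hC' hne).mono Set.inter_subset_left Set.inter_subset_left
  rw [Set.Finite.coe_toFinset] at hd
  simp only [Set.Finite.mem_toFinset] at hY
  rw [hY, hfin.ncard_biUnion (fun _ _ => Set.toFinite _) hd, finsum_mem_congr rfl hm,
    finsum_mem_eq_finite_toFinset_sum _ hfin, Finset.sum_const, smul_eq_mul,
    Set.ncard_eq_toFinset_card 𝒞 hfin]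

theorem finrank_pow_dvd_ncard {T : Set V} {W : Submodule (ZMod 2) V}
    (h : ∀ w ∈ W, ∀ v ∈ T, w + v ∈ T) : 2 ^ finrank (ZMod 2) W ∣ T.ncard := by
  have hT : T = (QuotientAddGroup.mk (s := W.toAddSubgroup)) ⁻¹'
      ((QuotientAddGroup.mk (s := W.toAddSubgroup)) '' T) := by
    refine Set.Subset.antisymm (Set.subset_preimage_image _ _) ?_
    rintro v ⟨t, ht, htv⟩
    have h1 : -t + v ∈ W := QuotientAddGroup.eq.1 htv
    have h2 := h _ h1 t ht
    rwa [neg_add_eq_sub, sub_add_cancel] at h2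
  have h1 := Nat.card_congr (QuotientAddGroup.preimageMkEquivAddSubgroupProdSet W.toAddSubgroup
    ((QuotientAddGroup.mk (s := W.toAddSubgroup)) '' T))
  rw [← hT, Nat.card_prod] at h1
  rw [← ncard_submodule]
  exact ⟨_, h1⟩

theorem not_hasMaximumCliquePartition_switchedGraph (hQ : IsNonsingularQuadric Q) {g s : ℕ}
    (hg : IsProjectiveIndex Q g) (hs : 0 < s) (hsg : s < g) (hα : LiesOn Q α)
    (hαs : finrank (ZMod 2) α = s + 1) : ¬ HasMaximumCliquePartition (switchedGraph Q α) := by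
  rintro ⟨𝒞, hpart, h𝒞⟩
  have := finite_of_finiteDimensional_zmod_two V
  have := finite_quadricPoint Q
  have hcases : ∀ C ∈ 𝒞,
      ((∀ a ∈ α, a ≠ 0 → a ∈ singularVector '' C) ∧ singularVector '' C ⊆ polarPerp Q α) ∨
      ((singularVector '' C ∩ α).ncard + 1 = 2 ^ s ∧
        (singularVector '' C ∩ {v | v ∈ polarPerp Q α ∧ v ∉ α}).ncard + 2 ^ s = 2 ^ g) := by
    intro C hC
    refine (isSwitchedClique_image hα (h𝒞 C hC).1).le_or_ncard_inter hg hsg hα hαs ?_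
    obtain ⟨D, hD, hDcard⟩ := exists_isClique_switchedGraph hg hα
    have h := (h𝒞 C hC).2 D hD
    rw [← D.toFinite.cast_ncard_eq, ← C.toFinite.cast_ncard_eq, Nat.cast_le] at h
    rw [Set.ncard_image_of_injective _ singularVector_injective]
    omega
  have hs2 : 2 ≤ 2 ^ s := Nat.le_self_pow hs.ne' 2
  by_cases hB : ∃ C ∈ 𝒞, (∀ a ∈ α, a ≠ 0 → a ∈ singularVector '' C) ∧
      singularVector '' C ⊆ polarPerp Q α
  · -- Any block through a point outside `α^⊥` meets the block containing `α`.
    obtain ⟨C, hC, hαC, hCα⟩ := hB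
    obtain ⟨v, hv, hvα⟩ := exists_singular_notMem_polarPerp hQ hα (by
      rintro rfl
      simp at hαs)
    obtain ⟨R, rfl⟩ := exists_singularVector_eq
      (fun h : v = 0 => hvα (h ▸ (polarPerp Q α).zero_mem)) hv
    obtain ⟨C', ⟨hC', hRC'⟩, -⟩ := hpart.2 R
    rcases hcases C' hC' with h | h
    · exact hvα (h.2 ⟨R, hRC', rfl⟩)
    · have hpos : 0 < (singularVector '' C' ∩ α).ncard := by omega
      obtain ⟨_, ⟨P, hP, rfl⟩, hPα⟩ := (Set.ncard_pos).1 hpos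
      obtain ⟨P', hP', hPP'⟩ := hαC _ hPα (singularVector_ne_zero P)
      rw [singularVector_injective hPP'] at hP'
      have hCC' : C = C' := (hpart.2 P).unique ⟨hC, hP'⟩ ⟨hC', hP⟩
      exact hvα (hCα ⟨R, hCC' ▸ hRC', rfl⟩)
  · -- Counting the points of `α` leaves only `s = 1` and three blocks; then the points of
    -- `α^⊥ \ α` are counted modulo four.
    have hcases' := fun C hC => (hcases C hC).resolve_left fun h => hB ⟨C, hC, h⟩
    have h1 := hpart.ncard_eq_mul {P | singularVector P ∈ α} (2 ^ s - 1) fun C hC => by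
      have := (hcases' C hC).1
      rw [← ncard_image_singularVector_inter C (fun v => v ∈ α)]
      change (singularVector '' C ∩ α).ncard = _
      omega
    have h2 := hpart.ncard_eq_mul {P | singularVector P ∈ polarPerp Q α ∧ singularVector P ∉ α}
      (2 ^ g - 2 ^ s) fun C hC => by
        have := (hcases' C hC).2
        rw [← ncard_image_singularVector_inter C (fun v => v ∈ polarPerp Q α ∧ v ∉ α)]
        omega
    have h3 : {P : QuadricPoint Q | singularVector P ∈ α}.ncard + 1 = 2 ^ (s + 1) := by
      have : {v | v ≠ 0 ∧ Q v = 0 ∧ v ∈ α} = (α : Set V) \ {0} := by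
        ext v
        exact ⟨fun h => ⟨h.2.2, h.1⟩, fun h => ⟨h.2, hα v h.1, h.1⟩⟩
      rw [ncard_setOf_singularVector (fun v => v ∈ α), this,
        Set.ncard_sdiff_singleton_add_one α.zero_mem, ncard_submodule, hαs]
    have h4 : 2 ^ (s + 1) ∣
        {P : QuadricPoint Q | singularVector P ∈ polarPerp Q α ∧ singularVector P ∉ α}.ncard := by
      rw [ncard_setOf_singularVector (fun v => v ∈ polarPerp Q α ∧ v ∉ α), ← hαs]
      refine finrank_pow_dvd_ncard fun p hp v hv => ?_
      exact add_mem_polarPerp_notMem hα hp hv.2.1 hv.2.2.1 hv.2.2.2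
    rw [h1, pow_succ] at h3
    rw [h2] at h4
    generalize 𝒞.ncard = k at h3 h4
    obtain ⟨m, hm⟩ : ∃ m, 2 ^ s = m + 1 := ⟨2 ^ s - 1, by omega⟩
    rw [hm, Nat.add_sub_cancel] at h3
    have hdvd : m ∣ 1 := by
      have h5 : m ∣ m * 2 + 1 := ⟨k, by rw [mul_comm m k]; omega⟩
      exact (Nat.dvd_add_right (Dvd.intro _ rfl)).1 h5
    obtain rfl : m = 1 := Nat.dvd_one.1 hdvd
    obtain rfl : s = 1 := Nat.pow_right_injective (le_refl 2) hm
    obtain ⟨j, rfl⟩ : ∃ j, g = j + 2 := ⟨g - 2, by omega⟩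
    obtain rfl : k = 3 := by omega
    have hj : 2 ^ (j + 2) = 2 ^ j * 4 := pow_add 2 j 2
    have hj0 : 0 < 2 ^ j := by positivity
    rw [hj] at h4
    omega

end SwitchedGraph

/-! ### The sign character and a spectral bound -/

section Sign

/-- The nontrivial additive character of `GF(2)`. -/
noncomputable def zmodTwoSign (a : ZMod 2) : ℝ := if a = 0 then 1 else -1

@[simp] theorem zmodTwoSign_zero : zmodTwoSign 0 = 1 := if_pos rfl

theorem zmodTwoSign_one : zmodTwoSign 1 = -1 := if_neg one_ne_zero

theorem zmodTwoSign_add (a b : ZMod 2) :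
    zmodTwoSign (a + b) = zmodTwoSign a * zmodTwoSign b := by
  rcases zmod_two_eq_zero_or_one a with rfl | rfl <;>
    rcases zmod_two_eq_zero_or_one b with rfl | rfl
  · simp
  · simp
  · simp
  · rw [show (1 : ZMod 2) + 1 = 0 from rfl, zmodTwoSign_one, zmodTwoSign_zero]
    norm_num

/-- If a real symmetric matrix satisfies `K² = b K + c` with `c > 0`, then its eigenvalues are the
two roots of `t² = b t + c`, which have opposite signs; so the positive root `l` bounds the
quadratic form of `K`. -/
theorem nonneg_toBilin'_smul_one_sub {ι : Type*} [Fintype ι] [DecidableEq ι]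
    (K : Matrix ι ι ℝ) (hK : K.transpose = K) {b c l : ℝ}
    (hKK : K * K = b • K + c • (1 : Matrix ι ι ℝ)) (hl : l * l = b * l + c) (hl0 : 0 < l)
    (hc : 0 < c) (u : ι → ℝ) : 0 ≤ Matrix.toBilin' (l • (1 : Matrix ι ι ℝ) - K) u u := by
  set M := l • (1 : Matrix ι ι ℝ) - K with hM
  have hMt : M.transpose = M := by
    rw [hM, Matrix.transpose_sub, Matrix.transpose_smul, Matrix.transpose_one, hK]
  have hMM : M * M = (2 * l - b) • M := by
    have h1 : M * M = (l * l) • (1 : Matrix ι ι ℝ) - (2 * l) • K + K * K := by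
      rw [hM, sub_mul, mul_sub, mul_sub, Matrix.smul_mul, Matrix.mul_smul, Matrix.smul_mul,
        Matrix.mul_smul, one_mul, one_mul, mul_one, smul_smul, two_mul, add_smul]
      abel
    rw [h1, hKK, hM, hl]
    ext i j
    simp only [Matrix.add_apply, Matrix.sub_apply, Matrix.smul_apply, smul_eq_mul]
    have : c = l * l - b * l := by linarith
    rw [this]
    ring
  have hpos : 0 < 2 * l - b := by
    have h1 : 0 < l * (2 * l - b) := by nlinarith
    exact pos_of_mul_pos_right h1 hl0.le
  have h2 : (2 * l - b) * Matrix.toBilin' M u u = (M.mulVec u) ⬝ᵥ (M.mulVec u) := by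
    rw [Matrix.toBilin'_apply', ← smul_eq_mul, ← dotProduct_smul, ← Matrix.smul_mulVec, ← hMM,
      ← Matrix.mulVec_mulVec, Matrix.dotProduct_mulVec, ← Matrix.mulVec_transpose, hMt]
  have h3 : 0 ≤ (M.mulVec u) ⬝ᵥ (M.mulVec u) :=
    Finset.sum_nonneg fun i _ => mul_self_nonneg _
  rw [← h2] at h3
  exact nonneg_of_mul_nonneg_right h3 hpos

end Sign

/-! ### The character matrix on singular vectors -/

section CharacterMatrix

open Module QuadraticMap

variable {V : Type*} [AddCommGroup V] [Module (ZMod 2) V] {Q : QuadraticForm (ZMod 2) V}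

/-- The matrix of the character `(-1) ^ B(x, y)` on the set of singular vectors. -/
noncomputable def characterMatrix (Q : QuadraticForm (ZMod 2) V) :
    Matrix {x : V // Q x = 0} {x : V // Q x = 0} ℝ :=
  Matrix.of fun x y => zmodTwoSign (polar Q x.1 y.1)

theorem characterMatrix_apply (x y : {x : V // Q x = 0}) :
    characterMatrix Q x y = zmodTwoSign (polar Q x.1 y.1) := rfl

theorem transpose_characterMatrix : (characterMatrix Q).transpose = characterMatrix Q := by
  ext x y
  rw [Matrix.transpose_apply, characterMatrix_apply, characterMatrix_apply, polar_comm]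

/-- Two singular vectors whose sum is orthogonal to the whole space are equal, as the sum lies in
the radical. -/
theorem add_mem_polarPerp_top_iff (hQ : IsNonsingularQuadric Q) (x y : {x : V // Q x = 0}) :
    x.1 + y.1 ∈ polarPerp Q ⊤ ↔ x = y := by
  constructor
  · intro h
    have h1 : ∀ v, polar Q (x.1 + y.1) v = 0 := fun v => (polar_comm Q _ v).trans (h v trivial)
    have hxy : polar Q x.1 y.1 = 0 := by
      have := h1 x.1
      rwa [polar_add_left, polar_self_eq_zero, zero_add, polar_comm] at this
    have h2 : x.1 + y.1 ∈ Q.radical := by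
      have h3 : Q (x.1 + y.1) = 0 := by
        rw [QuadraticMap.map_add Q, x.2, y.2, hxy, add_zero, add_zero]
      refine QuadraticMap.mem_radical_iff'.2 ⟨h3, fun v => ?_⟩
      rw [QuadraticMap.map_add Q, h3, h1, zero_add, add_zero]
    rw [hQ, Submodule.mem_bot] at h2
    have h4 := add_add_self_zmod_two x.1 y.1
    rw [h2, add_zero] at h4
    exact Subtype.ext h4
  · rintro rfl
    rw [add_self_zmod_two]
    exact Submodule.zero_mem _

variable [Fintype V]

open scoped Classical in
theorem sum_zmodTwoSign_polar (W : Submodule (ZMod 2) V) (v : V) :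
    ∑ x : W, zmodTwoSign (polar Q v x) =
      if v ∈ polarPerp Q W then 2 ^ finrank (ZMod 2) W else 0 := by
  split_ifs with hv
  · have h1 : ∀ x : W, zmodTwoSign (polar Q v x) = 1 := fun x => by
      rw [polar_comm, mem_polarPerp.1 hv x x.2, zmodTwoSign_zero]
    have h2 := ncard_submodule W
    rw [← Nat.card_coe_set_eq] at h2
    change Nat.card W = _ at h2
    simp only [h1, Finset.sum_const, Finset.card_univ, nsmul_eq_mul, mul_one]
    rw [← Nat.card_eq_fintype_card, h2]
    push_cast
    rfl
  · obtain ⟨w, hw, hvw⟩ : ∃ w ∈ W, polar Q v w ≠ 0 := by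
      by_contra! h
      exact hv fun w hw => (polar_comm Q w v).trans (h w hw)
    have hvw1 := (zmod_two_eq_zero_or_one _).resolve_left hvw
    have h1 := Equiv.sum_comp (Equiv.addLeft (⟨w, hw⟩ : W))
      (fun x : W => zmodTwoSign (polar Q v x))
    simp only [Equiv.coe_addLeft, Submodule.coe_add, polar_add_right, zmodTwoSign_add, hvw1,
      zmodTwoSign_one, neg_mul, one_mul, Finset.sum_neg_distrib] at h1
    linarith

open scoped Classical in
/-- The square of the character matrix; `∑ z, (-1) ^ Q z` is the Gauss sum of `Q`. The indicator
function of the singular vectors is `(1 + (-1) ^ Q) / 2`, and `Q z + B(w, z) = Q (w + z) + Q w`. -/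
theorem characterMatrix_mul_self (hQ : IsNonsingularQuadric Q) :
    characterMatrix Q * characterMatrix Q =
      ((∑ z : V, zmodTwoSign (Q z)) / 2) • characterMatrix Q +
        ((2 : ℝ) ^ finrank (ZMod 2) V / 2) • 1 := by
  ext x y
  set w := x.1 + y.1 with hw
  have hQw : Q w = polar Q x.1 y.1 := by
    rw [hw, QuadraticMap.map_add Q, x.2, y.2, zero_add, zero_add]
  have h1 : (characterMatrix Q * characterMatrix Q) x y =
      ∑ z : V, (1 + zmodTwoSign (Q z)) / 2 * zmodTwoSign (polar Q w z) := by
    rw [Matrix.mul_apply]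
    refine Fintype.sum_of_injective Subtype.val Subtype.val_injective _ _ ?_ ?_
    · intro z hz
      have hz' : Q z ≠ 0 := fun h => hz ⟨⟨z, h⟩, rfl⟩
      rw [(zmod_two_eq_zero_or_one _).resolve_left hz', zmodTwoSign_one]
      ring
    · intro z
      rw [characterMatrix_apply, characterMatrix_apply, polar_comm Q z.1 y.1, hw, polar_add_left,
        zmodTwoSign_add, z.2, zmodTwoSign_zero]
      ring
  have h2 : ∑ z : V, zmodTwoSign (polar Q w z) =
      if x = y then (2 : ℝ) ^ finrank (ZMod 2) V else 0 := by
    have h3 := sum_zmodTwoSign_polar (Q := Q) ⊤ w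
    rw [hw, add_mem_polarPerp_top_iff hQ, finrank_top] at h3
    refine ((Equiv.sum_comp (Submodule.topEquiv (R := ZMod 2) (M := V)).toEquiv
      (fun z => zmodTwoSign (polar Q w z))).symm.trans h3).trans ?_
    split_ifs <;> rfl
  have h3 : ∑ z : V, zmodTwoSign (Q z) * zmodTwoSign (polar Q w z) =
      (∑ z : V, zmodTwoSign (Q z)) * zmodTwoSign (polar Q x.1 y.1) := by
    rw [← Equiv.sum_comp (Equiv.addLeft w) (fun z => zmodTwoSign (Q z)), Finset.sum_mul]
    refine Finset.sum_congr rfl fun z _ => ?_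
    rw [← zmodTwoSign_add, ← hQw, ← zmodTwoSign_add, Equiv.coe_addLeft, QuadraticMap.map_add Q]
    congr 1
    rw [add_comm _ (Q w), add_assoc (Q w), ← add_assoc, CharTwo.add_self_eq_zero, zero_add]
  rw [h1]
  simp only [Matrix.add_apply, Matrix.smul_apply, smul_eq_mul, characterMatrix_apply,
    Matrix.one_apply]
  have h4 : ∀ z : V, (1 + zmodTwoSign (Q z)) / 2 * zmodTwoSign (polar Q w z) =
      zmodTwoSign (polar Q w z) / 2 + zmodTwoSign (Q z) * zmodTwoSign (polar Q w z) / 2 :=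
    fun z => by ring
  simp only [h4, Finset.sum_add_distrib, ← Finset.sum_div, h2, h3]
  split_ifs <;> ring

open scoped Classical in
/-- The indicator function of a subspace on the set of singular vectors. -/
noncomputable def singularIndicator (Q : QuadraticForm (ZMod 2) V) (W : Submodule (ZMod 2) V) :
    {x : V // Q x = 0} → ℝ :=
  fun x => if x.1 ∈ W then 1 else 0

open scoped Classical in
theorem sum_mul_singularIndicator {W : Submodule (ZMod 2) V} (hW : LiesOn Q W)
    (f : {x : V // Q x = 0} → ℝ) :
    ∑ x, f x * singularIndicator Q W x = ∑ x : W, f ⟨x, hW x x.2⟩ := by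
  symm
  refine Fintype.sum_of_injective (fun x : W => (⟨x, hW x x.2⟩ : {x : V // Q x = 0})) ?_ _ _ ?_ ?_
  · intro x y h
    exact Subtype.ext (Subtype.mk.inj h)
  · intro x hx
    have : x.1 ∉ W := fun h => hx ⟨⟨x.1, h⟩, rfl⟩
    rw [singularIndicator, if_neg this, mul_zero]
  · intro x
    rw [singularIndicator, if_pos x.2, mul_one]

open scoped Classical in
theorem characterMatrix_mulVec_singularIndicator {W : Submodule (ZMod 2) V} (hW : LiesOn Q W) :
    (characterMatrix Q).mulVec (singularIndicator Q W) =
      (2 : ℝ) ^ finrank (ZMod 2) W • singularIndicator Q (polarPerp Q W) := by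
  ext x
  have h := sum_mul_singularIndicator hW (characterMatrix Q x)
  rw [Matrix.mulVec, dotProduct, h]
  simp only [characterMatrix_apply]
  rw [sum_zmodTwoSign_polar, Pi.smul_apply, singularIndicator, smul_eq_mul, mul_ite, mul_one,
    mul_zero]

open scoped Classical in
theorem singularIndicator_dotProduct {W W' : Submodule (ZMod 2) V} (hW : LiesOn Q W) :
    singularIndicator Q W ⬝ᵥ singularIndicator Q W' =
      (2 : ℝ) ^ finrank (ZMod 2) ↥(W ⊓ W') := by
  have hW' : LiesOn Q (W ⊓ W') := fun v hv => hW v hv.1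
  have h := sum_mul_singularIndicator hW' (fun _ => 1)
  have h2 := ncard_submodule (W ⊓ W')
  rw [← Nat.card_coe_set_eq] at h2
  change Nat.card ↥(W ⊓ W') = _ at h2
  rw [Finset.sum_const, Finset.card_univ, nsmul_eq_mul, mul_one, ← Nat.card_eq_fintype_card,
    h2] at h
  push_cast at h
  rw [← h, dotProduct]
  refine Finset.sum_congr rfl fun x _ => ?_
  simp only [singularIndicator, Submodule.mem_inf]
  by_cases h1 : x.1 ∈ W <;> by_cases h2 : x.1 ∈ W' <;> simp [h1, h2]

open scoped Classical in
/-- The bilinear form of the matrix `2 ^ (g + 1) - K` on functions on the singular vectors, for `K`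
the character matrix. -/
noncomputable def characterForm (Q : QuadraticForm (ZMod 2) V) (g : ℕ) :
    LinearMap.BilinForm ℝ ({x : V // Q x = 0} → ℝ) :=
  Matrix.toBilin' ((2 : ℝ) ^ (g + 1) • 1 - characterMatrix Q)

theorem characterForm_singularIndicator (g : ℕ) {W W' : Submodule (ZMod 2) V} (hW : LiesOn Q W)
    (hW' : LiesOn Q W') :
    characterForm Q g (singularIndicator Q W) (singularIndicator Q W') =
      2 ^ (g + 1) * 2 ^ finrank (ZMod 2) ↥(W ⊓ W') -
        2 ^ finrank (ZMod 2) W' * 2 ^ finrank (ZMod 2) ↥(W ⊓ polarPerp Q W') := by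
  classical
  rw [characterForm, Matrix.toBilin'_apply', Matrix.sub_mulVec, Matrix.smul_mulVec,
    Matrix.one_mulVec, characterMatrix_mulVec_singularIndicator hW', dotProduct_sub,
    dotProduct_smul, dotProduct_smul, singularIndicator_dotProduct hW,
    singularIndicator_dotProduct hW, smul_eq_mul, smul_eq_mul]

/-- The number `2 ^ (g + 1)` is the largest eigenvalue of the character matrix; the indicator
function of a generator is an eigenvector. -/
theorem characterForm_self_nonneg (hQ : IsNonsingularQuadric Q) {g : ℕ}
    (hg : IsProjectiveIndex Q g) (u : {x : V // Q x = 0} → ℝ) : 0 ≤ characterForm Q g u u := by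
  classical
  obtain ⟨G, hG, hGg⟩ := hg.1
  have hKK := characterMatrix_mul_self hQ
  have hGG : singularIndicator Q (polarPerp Q G) = singularIndicator Q G := by
    ext x
    have : x.1 ∈ polarPerp Q G ↔ x.1 ∈ G :=
      ⟨mem_of_finrank_eq hg hG hGg x.2, fun h a ha => hG.polar_eq_zero ha h⟩
    simp only [singularIndicator, this]
  have hev := characterMatrix_mulVec_singularIndicator hG
  rw [hGg, hGG] at hev
  refine nonneg_toBilin'_smul_one_sub _ transpose_characterMatrix hKK ?_ (by positivity)
    (by positivity) u
  have h1 := congrArg (fun M => M.mulVec (singularIndicator Q G) ⟨0, QuadraticMap.map_zero Q⟩) hKK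
  simp only [← Matrix.mulVec_mulVec, hev, Matrix.mulVec_smul, Matrix.add_mulVec,
    Matrix.smul_mulVec, Matrix.one_mulVec, Pi.add_apply, Pi.smul_apply, smul_eq_mul] at h1
  have h2 : singularIndicator Q G ⟨0, QuadraticMap.map_zero Q⟩ = 1 := if_pos G.zero_mem
  rw [h2] at h1
  linarith

/-- The Bessel inequality for the positive semidefinite form `characterForm`: the indicator
functions of the members of `D` all have square norm `4 ^ g`, they have pairwise non-positive inner
products by the condition on dimensions, and each has inner product `2 ^ g` with the indicator
function of the zero vector, whose square norm is `2 ^ (g + 1) - 1`. -/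
theorem card_add_one_le_of_finrank_inf_lt (hQ : IsNonsingularQuadric Q) {g : ℕ}
    (hg : IsProjectiveIndex Q g) (D : Finset (Submodule (ZMod 2) V))
    (hD : ∀ H ∈ D, LiesOn Q H) (hDg : ∀ H ∈ D, finrank (ZMod 2) H = g)
    (hDD : ∀ H ∈ D, ∀ H' ∈ D, H ≠ H' →
      finrank (ZMod 2) ↥(H ⊓ H') < finrank (ZMod 2) ↥(H ⊓ polarPerp Q H')) :
    D.card + 1 ≤ 2 ^ (g + 1) := by
  classical
  have hbot : LiesOn Q (⊥ : Submodule (ZMod 2) V) := by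
    intro v hv
    rw [(Submodule.mem_bot _).1 hv, QuadraticMap.map_zero]
  set e := singularIndicator Q ⊥
  set f := ∑ H ∈ D, singularIndicator Q H with hf
  have hee : characterForm Q g e e = 2 ^ (g + 1) - 1 := by
    rw [characterForm_singularIndicator g hbot hbot, bot_inf_eq, bot_inf_eq, finrank_bot, pow_zero,
      mul_one, mul_one]
  have hef : characterForm Q g e f = D.card * 2 ^ g := by
    rw [hf, map_sum, Finset.sum_congr rfl (g := fun _ => (2 : ℝ) ^ g), Finset.sum_const,
      nsmul_eq_mul]
    intro H hH
    rw [characterForm_singularIndicator g hbot (hD H hH), hDg H hH, bot_inf_eq, bot_inf_eq,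
      finrank_bot]
    ring
  have hfe : characterForm Q g f e = D.card * 2 ^ g := by
    rw [hf, map_sum, LinearMap.sum_apply, Finset.sum_congr rfl (g := fun _ => (2 : ℝ) ^ g),
      Finset.sum_const, nsmul_eq_mul]
    intro H hH
    have : H ⊓ polarPerp Q ⊥ = H := inf_eq_left.2 fun v _ w hw => by
      rw [(Submodule.mem_bot _).1 hw]
      exact polar_zero_left Q v
    rw [characterForm_singularIndicator g (hD H hH) hbot, this, hDg H hH, inf_bot_eq, finrank_bot]
    ring
  have hff : characterForm Q g f f ≤ D.card * (2 ^ g * 2 ^ g) := by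
    have h1 : ∀ H ∈ D, ∑ H' ∈ D,
        characterForm Q g (singularIndicator Q H) (singularIndicator Q H') ≤ 2 ^ g * 2 ^ g := by
      intro H hH
      calc _ ≤ ∑ H' ∈ D, if H = H' then (2 : ℝ) ^ g * 2 ^ g else 0 := by
            refine Finset.sum_le_sum fun H' hH' => ?_
            rw [characterForm_singularIndicator g (hD H hH) (hD H' hH'), hDg H' hH']
            split_ifs with h
            · subst h
              have : H ⊓ polarPerp Q H = H :=
                inf_eq_left.2 fun v hv w hw => (hD H hH).polar_eq_zero hw hv
              rw [this, inf_idem, hDg H hH, pow_succ]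
              linarith
            · rw [sub_nonpos, ← pow_add, ← pow_add]
              have := hDD H hH H' hH' h
              exact pow_le_pow_right₀ (by norm_num) (by omega)
        _ = 2 ^ g * 2 ^ g := by rw [Finset.sum_ite_eq, if_pos hH]
    calc characterForm Q g f f = ∑ H ∈ D, ∑ H' ∈ D,
          characterForm Q g (singularIndicator Q H) (singularIndicator Q H') := by
          rw [hf, Finset.sum_comm]
          simp only [map_sum, LinearMap.sum_apply]
      _ ≤ ∑ H ∈ D, (2 : ℝ) ^ g * 2 ^ g := Finset.sum_le_sum h1
      _ = _ := by rw [Finset.sum_const, nsmul_eq_mul]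
  have hpos := characterForm_self_nonneg hQ hg ((2 : ℝ) ^ g • e - f)
  simp only [map_sub, map_smul, LinearMap.sub_apply, LinearMap.smul_apply, smul_eq_mul, hee, hef,
    hfe] at hpos
  have h2 : (0 : ℝ) < 2 ^ g * 2 ^ g := by positivity
  have h3 : (2 : ℝ) ^ g * 2 ^ g * (D.card + 1) ≤ 2 ^ g * 2 ^ g * 2 ^ (g + 1) := by linarith
  exact_mod_cast le_of_mul_le_mul_left h3 h2

end CharacterMatrix

/-! ### Cliques of Kantor's graph -/

section KantorGraph

open Module QuadraticMap

variable {V : Type*} [AddCommGroup V] [Module (ZMod 2) V] {Q : QuadraticForm (ZMod 2) V}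

theorem IsSpread.inf_eq_bot {g : ℕ} {𝒮 : Set (Submodule (ZMod 2) V)} (h𝒮 : IsSpread Q g 𝒮)
    {A B : Submodule (ZMod 2) V} (hA : A ∈ 𝒮) (hB : B ∈ 𝒮) (hAB : A ≠ B) : A ⊓ B = ⊥ := by
  by_contra h
  obtain ⟨v, hv, hv0⟩ := Submodule.exists_mem_ne_zero_of_ne_bot h
  obtain ⟨P, rfl⟩ := exists_singularVector_eq hv0 (h𝒮.liesOn A hA v hv.1)
  exact hAB ((h𝒮.existsUnique P.1 P.2).unique
    ⟨hA, submodule_le_iff_singularVector_mem.2 hv.1⟩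
    ⟨hB, submodule_le_iff_singularVector_mem.2 hv.2⟩)

variable [FiniteDimensional (ZMod 2) V]

theorem finrank_inf_lt_of_kantorGraph_adj {g : ℕ} {𝒮 : Set (Submodule (ZMod 2) V)}
    (h𝒮 : IsSpread Q g 𝒮) {X Y : SpreadHyperplane 𝒮} (h : (kantorGraph h𝒮).Adj X Y) :
    finrank (ZMod 2) ↥(X.1 ⊓ Y.1) < finrank (ZMod 2) ↥(X.1 ⊓ polarPerp Q Y.1) := by
  obtain ⟨hXY, hne⟩ := h
  obtain ⟨A, hA, hXA, hXr⟩ := X.2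
  obtain ⟨B, hB, hYB, hYr⟩ := Y.2
  by_cases hAB : A = B
  · subst hAB
    have h1 : X.1 ⊓ polarPerp Q Y.1 = X.1 :=
      inf_eq_left.2 fun v hv w hw => (h𝒮.liesOn A hA).polar_eq_zero (hYB hw) (hXA hv)
    rw [h1]
    refine finrank_inf_lt fun hle => hXY (Subtype.ext ?_)
    exact Submodule.eq_of_le_of_finrank_eq hle (by omega)
  · have h1 : X.1 ⊓ Y.1 = ⊥ :=
      le_bot_iff.1 ((inf_le_inf hXA hYB).trans (h𝒮.inf_eq_bot hA hB hAB).le)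
    rw [h1, finrank_bot]
    exact Nat.pos_of_ne_zero fun h0 => hne (Submodule.finrank_eq_zero.1 h0)

theorem ncard_add_one_le_of_isClique_kantorGraph (hQ : IsNonsingularQuadric Q) {g : ℕ}
    (hg : IsProjectiveIndex Q g) {𝒮 : Set (Submodule (ZMod 2) V)} (h𝒮 : IsSpread Q g 𝒮)
    {D : Set (SpreadHyperplane 𝒮)} (hD : (kantorGraph h𝒮).IsClique D) :
    D.ncard + 1 ≤ 2 ^ (g + 1) := by
  classical
  have := finite_of_finiteDimensional_zmod_two V
  have := Fintype.ofFinite V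
  have hfin := (Subtype.val '' D).toFinite
  rw [← Set.ncard_image_of_injective D Subtype.val_injective, Set.ncard_eq_toFinset_card _ hfin]
  refine card_add_one_le_of_finrank_inf_lt hQ hg _ ?_ ?_ ?_
  · intro H hH
    obtain ⟨X, -, rfl⟩ := hfin.mem_toFinset.1 hH
    obtain ⟨A, hA, hXA, -⟩ := X.2
    exact fun v hv => h𝒮.liesOn A hA v (hXA hv)
  · intro H hH
    obtain ⟨X, -, rfl⟩ := hfin.mem_toFinset.1 hH
    obtain ⟨A, hA, -, hXr⟩ := X.2
    have := h𝒮.finrank_eq A hA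
    omega
  · intro H hH H' hH' hne
    obtain ⟨X, hX, rfl⟩ := hfin.mem_toFinset.1 hH
    obtain ⟨Y, hY, rfl⟩ := hfin.mem_toFinset.1 hH'
    exact finrank_inf_lt_of_kantorGraph_adj h𝒮 (hD hX hY fun h => hne (congrArg _ h))

/-- Over `GF(2)`, the hyperplanes of `A` correspond to the nonzero linear functionals on `A`. -/
theorem le_ncard_hyperplanes_add_one {𝒮 : Set (Submodule (ZMod 2) V)} {A : Submodule (ZMod 2) V}
    (hA : A ∈ 𝒮) :
    2 ^ finrank (ZMod 2) A ≤ {X : SpreadHyperplane 𝒮 | X.1 ≤ A}.ncard + 1 := by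
  have := finite_of_finiteDimensional_zmod_two V
  have := finite_of_finiteDimensional_zmod_two (Dual (ZMod 2) A)
  have hr : ∀ φ : Dual (ZMod 2) A, φ ≠ 0 →
      finrank (ZMod 2) ((LinearMap.ker φ).map A.subtype) + 1 = finrank (ZMod 2) A := by
    intro φ hφ
    rw [LinearEquiv.finrank_eq (Submodule.equivSubtypeMap A _).symm]
    exact Module.Dual.finrank_ker_add_one_of_ne_zero hφ
  let F : {φ : Dual (ZMod 2) A // φ ≠ 0} → {X : SpreadHyperplane 𝒮 | X.1 ≤ A} := fun φ =>
    ⟨⟨(LinearMap.ker φ.1).map A.subtype, A, hA, Submodule.map_subtype_le _ _, hr φ.1 φ.2⟩,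
      Submodule.map_subtype_le _ _⟩
  have hF : Function.Injective F := by
    intro φ ψ h
    have h1 : (LinearMap.ker φ.1).map A.subtype = (LinearMap.ker ψ.1).map A.subtype :=
      congrArg (fun X => X.1.1) h
    have h2 := Submodule.map_injective_of_injective A.injective_subtype h1
    refine Subtype.ext (LinearMap.ext fun x => ?_)
    have h3 : φ.1 x = 0 ↔ ψ.1 x = 0 := by
      rw [← LinearMap.mem_ker, h2, LinearMap.mem_ker]
    rcases zmod_two_eq_zero_or_one (φ.1 x) with h4 | h4 <;>
      rcases zmod_two_eq_zero_or_one (ψ.1 x) with h5 | h5 <;> simp_all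
  have h1 := Nat.card_le_card_of_injective F hF
  have h2 : Nat.card {φ : Dual (ZMod 2) A // φ ≠ 0} + 1 = 2 ^ finrank (ZMod 2) A := by
    have h3 := Set.ncard_sdiff_singleton_add_one (Set.mem_univ (0 : Dual (ZMod 2) A))
    rw [Set.ncard_univ, Module.natCard_eq_pow_finrank (K := ZMod 2), Nat.card_zmod,
      Subspace.dual_finrank_eq] at h3
    have h4 : Set.univ \ {(0 : Dual (ZMod 2) A)} = {φ | φ ≠ 0} := by
      ext φ
      simp
    rw [← h3, h4]
    rfl
  rw [← h2]
  exact Nat.add_le_add_right h1 1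

/-- The hyperplanes of each member of the spread form a clique. -/
theorem hasMaximumCliquePartition_kantorGraph (hQ : IsNonsingularQuadric Q) {g : ℕ}
    (hg : IsProjectiveIndex Q g) (hg0 : 0 < g) {𝒮 : Set (Submodule (ZMod 2) V)}
    (h𝒮 : IsSpread Q g 𝒮) : HasMaximumCliquePartition (kantorGraph h𝒮) := by
  have := finite_of_finiteDimensional_zmod_two V
  have hX : ∀ X : SpreadHyperplane 𝒮, X.1 ≠ ⊥ := by
    intro X h
    obtain ⟨A, hA, -, hXr⟩ := X.2
    rw [h, finrank_bot, h𝒮.finrank_eq A hA] at hXr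
    omega
  refine ⟨(fun A => {X : SpreadHyperplane 𝒮 | X.1 ≤ A}) '' 𝒮, ⟨?_, ?_⟩, ?_⟩
  · rintro ⟨A, hA, h⟩
    have h1 := le_ncard_hyperplanes_add_one hA
    simp only at h
    rw [h, Set.ncard_empty, h𝒮.finrank_eq A hA] at h1
    have := Nat.one_lt_two_pow (Nat.succ_ne_zero g)
    omega
  · intro X
    obtain ⟨A, hA, hXA, -⟩ := X.2
    refine ⟨_, ⟨⟨A, hA, rfl⟩, hXA⟩, ?_⟩
    rintro _ ⟨⟨B, hB, rfl⟩, hXB⟩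
    by_contra hne
    have hAB : A ≠ B := by
      rintro rfl
      exact hne rfl
    exact hX X (le_bot_iff.1 ((le_inf hXA hXB).trans (h𝒮.inf_eq_bot hA hB hAB).le))
  · rintro _ ⟨A, hA, rfl⟩
    refine ⟨fun X hXA Y hYA hXY => ⟨hXY, ?_⟩, fun D hD => ?_⟩
    · have h1 : X.1 ⊓ polarPerp Q Y.1 = X.1 :=
        inf_eq_left.2 fun v hv w hw => (h𝒮.liesOn A hA).polar_eq_zero (hYA hw) (hXA hv)
      change X.1 ⊓ polarPerp Q Y.1 ≠ ⊥
      rw [h1]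
      exact hX X
    · have h1 := ncard_add_one_le_of_isClique_kantorGraph hQ hg h𝒮 hD
      have h2 := le_ncard_hyperplanes_add_one hA
      rw [h𝒮.finrank_eq A hA] at h2
      rw [← D.toFinite.cast_ncard_eq, ← (Set.toFinite _).cast_ncard_eq, Nat.cast_le]
      change D.ncard ≤ {X : SpreadHyperplane 𝒮 | X.1 ≤ A}.ncard
      omega

end KantorGraph

/-! ### Invariance under isomorphism -/

section Isomorphism

theorem HasMaximumCliquePartition.of_iso {U U' : Type*} {G : SimpleGraph U} {G' : SimpleGraph U'}
    (e : G ≃g G') (h : HasMaximumCliquePartition G) : HasMaximumCliquePartition G' := by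
  obtain ⟨𝒞, ⟨hne, hex⟩, h𝒞⟩ := h
  refine ⟨(fun C => e '' C) '' 𝒞, ⟨?_, fun a => ?_⟩, ?_⟩
  · rintro ⟨C, hC, h⟩
    exact hne (Set.image_eq_empty.1 h ▸ hC)
  · obtain ⟨C, ⟨hC, haC⟩, huniq⟩ := hex (e.symm a)
    refine ⟨e '' C, ⟨⟨C, hC, rfl⟩, e.symm a, haC, e.apply_symm_apply a⟩, ?_⟩
    rintro _ ⟨⟨C', hC', rfl⟩, x, hx, rfl⟩
    rw [e.symm_apply_apply] at huniq
    exact congrArg _ (huniq C' ⟨hC', hx⟩)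
  · rintro _ ⟨C, hC, rfl⟩
    refine ⟨?_, fun D hD => ?_⟩
    · rintro _ ⟨x, hx, rfl⟩ _ ⟨y, hy, rfl⟩ hxy
      exact e.map_adj_iff.2 ((h𝒞 C hC).1 hx hy fun h => hxy (congrArg e h))
    · have h1 := (h𝒞 C hC).2 (e.symm '' D) (by
        rintro _ ⟨x, hx, rfl⟩ _ ⟨y, hy, rfl⟩ hxy
        exact e.symm.map_adj_iff.2 (hD hx hy fun h => hxy (congrArg e.symm h)))
      rwa [e.symm.injective.encard_image, ← e.injective.encard_image C] at h1

end Isomorphism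

theorem theorem6p1 {V : Type*} [AddCommGroup V] [Module (ZMod 2) V]
    [FiniteDimensional (ZMod 2) V] (Q : QuadraticForm (ZMod 2) V)
    (hQ : IsNonsingularQuadric Q) (g : ℕ) (hg : IsProjectiveIndex Q g)
    (s : ℕ) (hs : 0 < s) (hsg : s < g)
    (α : Submodule (ZMod 2) V) (hα : LiesOn Q α) (hαs : Module.finrank (ZMod 2) α = s + 1) :
    ¬ HasMaximumCliquePartition (switchedGraph Q α) ∧
      ∀ (𝒮 : Set (Submodule (ZMod 2) V)) (h𝒮 : IsSpread Q g 𝒮),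
        HasMaximumCliquePartition (kantorGraph h𝒮) ∧
          IsEmpty (kantorGraph h𝒮 ≃g switchedGraph Q α) := by
  have h1 := not_hasMaximumCliquePartition_switchedGraph hQ hg hs hsg hα hαs
  refine ⟨h1, fun 𝒮 h𝒮 => ?_⟩
  have h2 := hasMaximumCliquePartition_kantorGraph hQ hg (hs.trans hsg) h𝒮
  exact ⟨h2, ⟨fun e => h1 (h2.of_iso e)⟩⟩
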